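/- Theorem 1.3. For a finite positive measure $\nu$ on $[0,1]$ put $s_n(\nu)=\int_0^1t^n\,d\nu(t)$, $n\ge 0$. There is exactly one probability measure $\mu$ on $[0,1]$ (the fixed-point measure) whose moment sequence is a fixed point of the transformation $T((s_n)_n)_n=1/(s_0+s_1+\cdots+s_n)$, that is, such that $m_n=s_n(\mu)$ satisfies $m_n=1/(m_0+\cdots+m_n)$ for all $n\ge 0$. Its Bernstein transform $$f(z)=\int_0^1\frac{1-t^z}{1-t}\,d\mu(t),\qquad \Re z>0$$ (the integrand being read as $z$ at $t=1$) has a unique extension to a meromorphic function on $\mathbb C$, again denoted $f$, which is regarded as a map from $\mathbb C$ to the Riemann sphere $\mathbb C^*=\mathbb C\cup\{\infty\}$ with value $\infty$ at the poles. Let $\lambda_0=0$ and $\lambda_{n+1}=\frac12\left(\lambda_n+\sqrt{\lambda_n^2+4}\right)$ for $n\ge 0$, and define entire functions $$a_n(z)=\lambda_n\left(\frac{\lambda_n}{\lambda_{n-1}}\right)^z\ (n\ge 2),\qquad b_n(z)=\lambda_n\left(\frac{\lambda_{n+1}}{\lambda_n}\right)^z\ (n\ge 1).$$ Let $\psi:\mathbb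 C^*\to\mathbb C^*$ be given by $\psi(z)=z-1/z$, with $\psi(0)=\psi(\infty)=\infty$, and let $\psi^{\circ n}$ be its $n$-th iterate. Then for all $z\in\mathbb C$ $$f(z)=\lim_{n\to\infty}\psi^{\circ n}(a_n(z))=\lim_{n\to\infty}\psi^{\circ n}(b_n(z))$$ in $\mathbb C^*$, and in both cases the convergence is uniform on compact subsets of $\mathbb C$ with respect to the chordal metric on $\mathbb C^*$. -/

import Mathlib

open Filter Topology
open scoped OnePoint

noncomputable section

namespace FixedPointMeasure

/-- The `n`-th moment of a measure on `[0,1]`. -/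
def moment (ν : MeasureTheory.Measure unitInterval) (n : ℕ) : ℝ :=
  ∫ t, (t : ℝ) ^ n ∂ν

/-- The non-linear transformation `T((a_n))_n = 1 / (a_0 + ⋯ + a_n)` of sequences. -/
def T (a : ℕ → ℝ) (n : ℕ) : ℝ :=
  1 / ∑ k ∈ Finset.range (n + 1), a k

/-- A fixed point measure: a probability measure on `[0,1]` whose moment sequence is fixed
by `T` (the measure induced by `T` is the one having the transformed moment sequence). -/
structure IsFixedPointMeasure (μ : MeasureTheory.Measure unitInterval) : Prop where
  isProbabilityMeasure : MeasureTheory.IsProbabilityMeasure μ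
  fixed : T (moment μ) = moment μ

/-- The integrand `(1 - t^z) / (1 - t)`, with its continuous value `z` at `t = 1`. -/
def bernsteinKernel (z : ℂ) (t : ℝ) : ℂ :=
  if t = 1 then z else (1 - (t : ℂ) ^ z) / (1 - (t : ℂ))

/-- The Bernstein transform `∫ (1 - t^z) / (1 - t) dμ(t)`, used for `Re z > 0`. -/
def bernstein (μ : MeasureTheory.Measure unitInterval) (z : ℂ) : ℂ :=
  ∫ t, bernsteinKernel z (t : ℝ) ∂μ

/-- `f` is a meromorphic function on the whole plane that agrees with the Bernstein transform
of `μ` on `Re z > 0`. Normal form means that removable singularities are filled in, and that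
the complex number stored by `f` at a pole is `0`; that number is never used, as the value at a
pole is taken to be `∞` by `sphereValue`. -/
structure IsMeromorphicExtension (μ : MeasureTheory.Measure unitInterval) (f : ℂ → ℂ) :
    Prop where
  meromorphic : MeromorphicNFOn f Set.univ
  extends_bernstein : ∀ z : ℂ, 0 < z.re → f z = bernstein μ z

open Classical in
/-- The value in the Riemann sphere of a meromorphic function in normal form:
`∞` at a pole, `f z` elsewhere. -/
def sphereValue (f : ℂ → ℂ) (z : ℂ) : OnePoint ℂ :=
  if meromorphicOrderAt f z < 0 then ∞ else (f z : OnePoint ℂ)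

/-- The rational map `ψ(z) = z - 1/z` of the Riemann sphere, `ψ(0) = ψ(∞) = ∞`. -/
def psi : OnePoint ℂ → OnePoint ℂ
  | ∞ => ∞
  | (z : ℂ) => if z = 0 then ∞ else ((z - 1 / z : ℂ) : OnePoint ℂ)

/-- The chordal metric on the Riemann sphere. -/
def chordalDist : OnePoint ℂ → OnePoint ℂ → ℝ
  | ∞, ∞ => 0
  | ∞, (w : ℂ) => 2 / √(1 + ‖w‖ ^ 2)
  | (z : ℂ), ∞ => 2 / √(1 + ‖z‖ ^ 2)
  | (z : ℂ), (w : ℂ) => 2 * ‖z - w‖ / (√(1 + ‖z‖ ^ 2) * √(1 + ‖w‖ ^ 2))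

/-- Uniform convergence on `K`, in the chordal metric, of sphere-valued functions. -/
def ChordalTendstoUniformlyOn (F : ℕ → ℂ → OnePoint ℂ) (f : ℂ → OnePoint ℂ) (K : Set ℂ) :
    Prop :=
  ∀ ε : ℝ, 0 < ε → ∃ N : ℕ, ∀ n : ℕ, N ≤ n → ∀ z ∈ K, chordalDist (F n z) (f z) < ε

/-- `λ_0 = 0`, `λ_{n+1} = (λ_n + √(λ_n² + 4)) / 2`. -/
def lam : ℕ → ℝ
  | 0 => 0
  | n + 1 => (lam n + √(lam n ^ 2 + 4)) / 2

/-- `a_n(z) = λ_n (λ_n / λ_{n-1})^z`, meaningful for `n ≥ 2`. -/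
def a (n : ℕ) (z : ℂ) : ℂ :=
  (lam n : ℂ) * ((lam n / lam (n - 1) : ℝ) : ℂ) ^ z

/-- `b_n(z) = λ_n (λ_{n+1} / λ_n)^z`, meaningful for `n ≥ 1`. -/
def b (n : ℕ) (z : ℂ) : ℂ :=
  (lam n : ℂ) * ((lam (n + 1) / lam n : ℝ) : ℂ) ^ z

end FixedPointMeasure

end

/-! ### The sequence `lam` -/

namespace FixedPointMeasure

/-! The relation `lam_succ_mul_sub` says that `psi` sends λ_{k+1} to λ_k and that the partial sums
of 1/λ_{k+1} telescope to λ_n. Hence the only possible moments of a fixed point are m_n = 1/λ_{n+1}.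
These are completely monotone (`bdiff_iterate_inv_lam_nonneg`), so Hausdorff's theorem
(`exists_moment_eq`) yields the measure, and moments determine it.

The Bernstein transform f satisfies f(n) = λ_n at positive integers. The multiplicative convolution
of μ with the law whose transform is f(z+1)/(z+1) therefore has the moments of Lebesgue measure,
hence is Lebesgue measure. Reading this at complex z gives f(z+1)·∫t^z dμ = 1, that is, f(z) =
ψ(f(z+1)) for Re z > 0 (`bernstein_eq_sub_inv`). So ψ^m(f(z+m)) does not depend on m once Re(z+m) >
0, and it defines the meromorphic extension.

For the limits, f(z+n), a_n(z) and b_n(z) all equal λ_n + z/λ_n + O(λ_n⁻³), uniformly for bounded z.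
Going down from level k+1 to level k, ψ multiplies an error by about 1 + λ⁻², while λ_k² shrinks by
a compensating factor, so errors weighted by λ_k² do not grow (`psi_error_step`). An initial
weighted error O(1/λ_n) thus remains O(1/λ_n) down to a fixed level m. The remaining m applications
of ψ are continuous, and 4^m-Lipschitz in the chordal metric. -/

theorem lam_succ_mul_sub (k : ℕ) : lam (k + 1) * (lam (k + 1) - lam k) = 1 := by
  have h : √(lam k ^ 2 + 4) ^ 2 = lam k ^ 2 + 4 := Real.sq_sqrt (by positivity)
  simp only [lam]
  nlinarith

theorem lam_nonneg (k : ℕ) : 0 ≤ lam k := by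
  induction k with
  | zero => simp [lam]
  | succ k ih => simp only [lam]; positivity

theorem lam_succ_pos (k : ℕ) : 0 < lam (k + 1) := by
  refine (lam_nonneg _).lt_of_ne fun h => ?_
  simpa [← h] using lam_succ_mul_sub k

theorem lam_succ_sub (k : ℕ) : lam (k + 1) - lam k = 1 / lam (k + 1) := by
  rw [eq_div_iff (lam_succ_pos k).ne', mul_comm, lam_succ_mul_sub]

theorem lam_lt_succ (k : ℕ) : lam k < lam (k + 1) := by
  have := lam_succ_sub k
  have := one_div_pos.2 (lam_succ_pos k)
  linarith

theorem lam_strictMono : StrictMono lam := strictMono_nat_of_lt_succ lam_lt_succ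

@[simp] theorem lam_zero : lam 0 = 0 := rfl

@[simp] theorem lam_one : lam 1 = 1 := by
  have := lam_succ_mul_sub 0
  have := lam_succ_pos 0
  simp only [zero_add, lam_zero, sub_zero] at *
  nlinarith

theorem one_le_lam_succ (k : ℕ) : 1 ≤ lam (k + 1) := by
  simpa using lam_strictMono.monotone (Nat.succ_le_succ (Nat.zero_le k))

theorem lam_succ_le (k : ℕ) : lam (k + 1) ≤ lam k + 1 := by
  have := lam_succ_sub k
  have : 1 / lam (k + 1) ≤ 1 := by
    rw [div_le_one (lam_succ_pos k)]; exact one_le_lam_succ k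
  linarith

theorem lam_add_le (k p : ℕ) : lam (k + p) ≤ lam k + p := by
  induction p with
  | zero => simp
  | succ p ih => have := lam_succ_le (k + p); push_cast; rw [← add_assoc]; linarith

/-- By the recursion, λ_{k+1}² = 1 + λ_{k+1}λ_k ≥ 1 + λ_k². This gives divergence at rate at least
√k. -/
theorem le_lam_sq (k : ℕ) : (k : ℝ) ≤ lam k ^ 2 := by
  induction k with
  | zero => simp
  | succ k ih =>
    have h := lam_succ_mul_sub k
    have := lam_lt_succ k
    have := lam_nonneg k
    push_cast
    nlinarith

theorem tendsto_lam : Tendsto lam atTop atTop := by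
  exact tendsto_atTop_mono (fun k => Real.sqrt_le_iff.2 ⟨lam_nonneg k, le_lam_sq k⟩)
    (Real.tendsto_sqrt_atTop.comp tendsto_natCast_atTop_atTop)

theorem sum_inv_lam (n : ℕ) : ∑ k ∈ Finset.range n, 1 / lam (k + 1) = lam n := by
  induction n with
  | zero => simp
  | succ n ih => rw [Finset.sum_range_succ, ih, ← lam_succ_sub]; ring

/-! ### The map `psi` on the sphere and the chordal metric -/

theorem psi_infty : psi ∞ = ∞ := rfl

theorem psi_zero : psi ((0 : ℂ) : OnePoint ℂ) = ∞ := if_pos rfl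

theorem psi_coe {z : ℂ} (hz : z ≠ 0) : psi (z : OnePoint ℂ) = ((z - 1 / z : ℂ) : OnePoint ℂ) :=
  if_neg hz

theorem chordalDist_coe (z w : ℂ) : chordalDist (z : OnePoint ℂ) w =
    2 * ‖z - w‖ / (√(1 + ‖z‖ ^ 2) * √(1 + ‖w‖ ^ 2)) := rfl

theorem chordalDist_infty_coe (w : ℂ) :
    chordalDist ∞ (w : OnePoint ℂ) = 2 / √(1 + ‖w‖ ^ 2) := rfl

theorem chordalDist_infty : chordalDist ∞ ∞ = 0 := rfl

theorem chordalDist_comm (p q : OnePoint ℂ) : chordalDist p q = chordalDist q p := by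
  induction p using OnePoint.rec <;> induction q using OnePoint.rec
  · rfl
  · rfl
  · rfl
  · rw [chordalDist_coe, chordalDist_coe, norm_sub_rev, mul_comm √_]

theorem chordalDist_nonneg (p q : OnePoint ℂ) : 0 ≤ chordalDist p q := by
  induction p using OnePoint.rec <;> induction q using OnePoint.rec <;>
    simp only [chordalDist] <;> positivity

theorem chordalDist_coe_le (z w : ℂ) : chordalDist (z : OnePoint ℂ) w ≤ 2 * ‖z - w‖ := by
  rw [chordalDist_coe]
  refine div_le_self (by positivity) (one_le_mul_of_one_le_of_one_le ?_ ?_) <;>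
    exact Real.one_le_sqrt.2 (by nlinarith [sq_nonneg ‖z‖, sq_nonneg ‖w‖])

/-- The left side expands to 4 + (‖w‖ - ‖1/w‖)². Since |ψ'(w)| ≤ 1 + ‖1/w‖², this bounds the
spherical derivative of ψ by 4, the Lipschitz constant used below. -/
theorem spherical_bound {w : ℂ} (hw : w ≠ 0) :
    (1 + ‖1 / w‖ ^ 2) * (1 + ‖w‖ ^ 2) ≤ 4 * (1 + ‖w - 1 / w‖ ^ 2) := by
  have h1 : (‖w‖ - ‖1 / w‖) ^ 2 ≤ ‖w - 1 / w‖ ^ 2 := by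
    rw [← sq_abs]
    exact pow_le_pow_left₀ (abs_nonneg _) (abs_norm_sub_norm_le _ _) 2
  have h2 : ‖w‖ * ‖1 / w‖ = 1 := by
    rw [← norm_mul, mul_one_div_cancel hw, norm_one]
  nlinarith [sq_nonneg (‖w‖ - ‖1 / w‖)]

theorem sqrt_spherical_bound {w : ℂ} (hw : w ≠ 0) :
    √(1 + ‖1 / w‖ ^ 2) * √(1 + ‖w‖ ^ 2) ≤ 2 * √(1 + ‖w - 1 / w‖ ^ 2) := by
  rw [← Real.sqrt_mul (by positivity)]
  refine (Real.sqrt_le_sqrt (spherical_bound hw)).trans_eq ?_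
  rw [Real.sqrt_mul (by norm_num)]
  congr 1
  rw [show (4 : ℝ) = 2 ^ 2 by norm_num]
  exact Real.sqrt_sq (by norm_num)

theorem one_le_sqrt_one_add (x : ℝ) : 1 ≤ √(1 + x ^ 2) :=
  Real.one_le_sqrt.2 (by nlinarith [sq_nonneg x])

theorem norm_one_add_inv_mul_le (z w : ℂ) :
    ‖1 + 1 / z * (1 / w)‖ ≤ √(1 + ‖1 / z‖ ^ 2) * √(1 + ‖1 / w‖ ^ 2) := by
  refine (norm_add_le _ _).trans ?_
  rw [norm_one, norm_mul, ← Real.sqrt_mul (by positivity)]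
  apply Real.le_sqrt_of_sq_le
  nlinarith [sq_nonneg (‖1 / z‖ - ‖1 / w‖)]

theorem chordalDist_infty_psi_le (w : ℂ) :
    chordalDist ∞ (psi w) ≤ 4 * chordalDist ∞ (w : OnePoint ℂ) := by
  rcases eq_or_ne w 0 with rfl | hw
  · rw [psi_zero, chordalDist_infty]
    exact mul_nonneg (by norm_num) (chordalDist_nonneg _ _)
  rw [psi_coe hw, chordalDist_infty_coe, chordalDist_infty_coe, ← mul_div_assoc,
    div_le_div_iff₀ (by positivity) (by positivity)]
  have := sqrt_spherical_bound hw
  nlinarith [one_le_sqrt_one_add ‖1 / w‖, one_le_sqrt_one_add ‖w‖]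

theorem chordalDist_infty_psi_le_zero (w : ℂ) :
    chordalDist ∞ (psi w) ≤ 4 * chordalDist ((0 : ℂ) : OnePoint ℂ) w := by
  rcases eq_or_ne w 0 with rfl | hw
  · rw [psi_zero, chordalDist_infty]
    exact mul_nonneg (by norm_num) (chordalDist_nonneg _ _)
  rw [psi_coe hw, chordalDist_infty_coe, chordalDist_coe, ← mul_div_assoc,
    div_le_div_iff₀ (by positivity) (by positivity)]
  have h := sqrt_spherical_bound hw
  have h1 : 1 ≤ ‖w‖ * √(1 + ‖1 / w‖ ^ 2) := by
    have : ‖1 / w‖ ≤ √(1 + ‖1 / w‖ ^ 2) := Real.le_sqrt_of_sq_le (by linarith)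
    have h2 : ‖w‖ * ‖1 / w‖ = 1 := by
      rw [← norm_mul, mul_one_div_cancel hw, norm_one]
    nlinarith [norm_nonneg w]
  have h3 := mul_le_mul_of_nonneg_left h (norm_nonneg w)
  have h4 := mul_le_mul_of_nonneg_right h1 (Real.sqrt_nonneg (1 + ‖w‖ ^ 2))
  simp only [zero_sub, norm_neg, norm_zero, ne_eq, OfNat.ofNat_ne_zero, not_false_eq_true, zero_pow,
    add_zero, Real.sqrt_one, one_mul] at *
  have h5 : 0 ≤ ‖w‖ * √(1 + ‖w - 1 / w‖ ^ 2) := by positivity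
  linarith

/-- The rational map `psi` is Lipschitz for the chordal metric. -/
theorem chordalDist_psi_le (p q : OnePoint ℂ) :
    chordalDist (psi p) (psi q) ≤ 4 * chordalDist p q := by
  induction p using OnePoint.rec with
  | infty =>
    induction q using OnePoint.rec with
    | infty => simp [psi_infty, chordalDist_infty]
    | coe w => exact chordalDist_infty_psi_le w
  | coe z =>
    induction q using OnePoint.rec with
    | infty =>
      rw [chordalDist_comm, chordalDist_comm _ ∞]
      exact chordalDist_infty_psi_le z
    | coe w =>
      rcases eq_or_ne z 0 with rfl | hz
      · rw [psi_zero]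
        exact chordalDist_infty_psi_le_zero w
      rcases eq_or_ne w 0 with rfl | hw
      · rw [psi_zero, chordalDist_comm, chordalDist_comm (z : OnePoint ℂ)]
        exact chordalDist_infty_psi_le_zero z
      rw [psi_coe hz, psi_coe hw, chordalDist_coe, chordalDist_coe, ← mul_div_assoc,
        div_le_div_iff₀ (by positivity) (by positivity)]
      have e : z - 1 / z - (w - 1 / w) = (z - w) * (1 + 1 / z * (1 / w)) := by
        field_simp
        ring
      have h1 := norm_one_add_inv_mul_le z w
      have h2 := mul_le_mul (sqrt_spherical_bound hz) (sqrt_spherical_bound hw)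
        (by positivity) (by positivity)
      rw [e, norm_mul]
      calc 2 * (‖z - w‖ * ‖1 + 1 / z * (1 / w)‖) * (√(1 + ‖z‖ ^ 2) * √(1 + ‖w‖ ^ 2))
          ≤ 2 * (‖z - w‖ * (√(1 + ‖1 / z‖ ^ 2) * √(1 + ‖1 / w‖ ^ 2))) *
            (√(1 + ‖z‖ ^ 2) * √(1 + ‖w‖ ^ 2)) := by gcongr
        _ = 2 * ‖z - w‖ * (√(1 + ‖1 / z‖ ^ 2) * √(1 + ‖z‖ ^ 2) *
            (√(1 + ‖1 / w‖ ^ 2) * √(1 + ‖w‖ ^ 2))) := by ring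
        _ ≤ 2 * ‖z - w‖ * (2 * √(1 + ‖z - 1 / z‖ ^ 2) * (2 * √(1 + ‖w - 1 / w‖ ^ 2))) := by
          gcongr
        _ = _ := by ring

theorem chordalDist_psi_iterate_le (m : ℕ) (p q : OnePoint ℂ) :
    chordalDist (psi^[m] p) (psi^[m] q) ≤ 4 ^ m * chordalDist p q := by
  induction m with
  | zero => simp
  | succ m ih =>
    rw [Function.iterate_succ_apply', Function.iterate_succ_apply', pow_succ']
    have := chordalDist_psi_le (psi^[m] p) (psi^[m] q)
    linarith

theorem tendsto_sub_inv_cobounded :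
    Tendsto (fun z : ℂ => z - 1 / z) (Bornology.cobounded ℂ) (Bornology.cobounded ℂ) := by
  rw [← tendsto_norm_atTop_iff_cobounded]
  refine tendsto_atTop_mono' _ ?_
    (tendsto_atTop_add_const_right _ (-1) (tendsto_norm_cobounded_atTop (E := ℂ)))
  filter_upwards [(tendsto_norm_cobounded_atTop (E := ℂ)).eventually_ge_atTop 1] with z hz
  have h1 := norm_sub_norm_le z (1 / z)
  have h2 : ‖1 / z‖ ≤ 1 := by
    rw [norm_div, norm_one]
    exact div_le_one_of_le₀ hz (by positivity)
  linarith

theorem tendsto_coe_cobounded :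
    Tendsto ((↑) : ℂ → OnePoint ℂ) (Bornology.cobounded ℂ) (𝓝 ∞) := by
  rw [Metric.cobounded_eq_cocompact, ← coclosedCompact_eq_cocompact]
  exact OnePoint.tendsto_coe_infty

theorem continuous_psi : Continuous psi := by
  rw [continuous_iff_continuousAt]
  intro p
  have hcomp := tendsto_coe_cobounded.comp tendsto_sub_inv_cobounded
  induction p using OnePoint.rec with
  | infty =>
    rw [OnePoint.continuousAt_infty', coclosedCompact_eq_cocompact,
      ← Metric.cobounded_eq_cocompact, psi_infty]
    refine hcomp.congr' ?_
    filter_upwards [(tendsto_norm_cobounded_atTop (E := ℂ)).eventually_ge_atTop 1] with w hw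
    exact (psi_coe (norm_pos_iff.1 (by linarith))).symm
  | coe z =>
    rw [OnePoint.continuousAt_coe]
    rcases eq_or_ne z 0 with rfl | hz
    · rw [continuousAt_iff_punctured_nhds]
      simp only [Function.comp_apply, psi_zero]
      have h : Tendsto (fun z : ℂ => z - 1 / z) (𝓝[≠] 0) (Bornology.cobounded ℂ) := by
        rw [← tendsto_norm_atTop_iff_cobounded]
        refine (tendsto_norm_atTop_iff_cobounded.2
          (tendsto_sub_inv_cobounded.comp (tendsto_inv₀_nhdsNE_zero (α := ℂ)))).congr fun w => ?_
        simp [norm_sub_rev]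
      refine (tendsto_coe_cobounded.comp h).congr' ?_
      filter_upwards [self_mem_nhdsWithin] with w hw
      exact (psi_coe hw).symm
    · have h : ContinuousAt (fun w : ℂ => ((w - 1 / w : ℂ) : OnePoint ℂ)) z :=
        OnePoint.continuous_coe.continuousAt.comp
          (continuousAt_id.sub (continuousAt_const.div continuousAt_id hz))
      refine h.congr ?_
      filter_upwards [isOpen_ne.mem_nhds hz] with w hw
      exact (psi_coe hw).symm

/-! ### Backward propagation of errors -/

/-- One step of the backward error recursion: weighted by `lam k ^ 2`, errors do not grow. -/
theorem psi_error_step {k : ℕ} (hk : 8 ≤ lam (k + 1)) {v w : ℂ}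
    (hw : ‖w - lam (k + 1)‖ ≤ 1) {E : ℝ} (hE : E ≤ 1)
    (hv : ‖v - w‖ * lam (k + 1) ^ 2 ≤ E) :
    v ≠ 0 ∧ ‖v - 1 / v - (w - 1 / w)‖ * lam k ^ 2 ≤ E := by
  set l := lam (k + 1) with hl
  have hvw : ‖v - w‖ ≤ 1 := by nlinarith [norm_nonneg (v - w)]
  have hnl : ‖(l : ℂ)‖ = l := by rw [Complex.norm_real, Real.norm_of_nonneg (by linarith)]
  have hwn : l - 1 ≤ ‖w‖ := by
    have := norm_sub_norm_le (l : ℂ) w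
    rw [norm_sub_rev, hnl] at this
    linarith
  have hvn : l - 2 ≤ ‖v‖ := by
    have := norm_sub_norm_le w v
    rw [norm_sub_rev] at this
    linarith
  have hv0 : v ≠ 0 := norm_pos_iff.1 (by linarith)
  have hw0 : w ≠ 0 := norm_pos_iff.1 (by linarith)
  refine ⟨hv0, ?_⟩
  have e : v - 1 / v - (w - 1 / w) = (v - w) * (1 + 1 / (v * w)) := by
    field_simp
    ring
  -- The bound is (l-1)(l-2) ≥ l²/2, valid since l ≥ 8.
  have hprod : l ^ 2 / 2 ≤ ‖v * w‖ := by
    rw [norm_mul]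
    nlinarith
  have hinv : ‖1 + 1 / (v * w)‖ ≤ 1 + 2 * (1 / l ^ 2) := by
    refine (norm_add_le _ _).trans ?_
    rw [norm_one, norm_div, norm_one]
    gcongr
    calc 1 / ‖v * w‖ ≤ 1 / (l ^ 2 / 2) := by gcongr
      _ = 2 * (1 / l ^ 2) := by field_simp
  have hk' : lam k = l * (1 - 1 / l ^ 2) := by
    have := lam_succ_sub k
    rw [← hl] at this
    have h0 : l ≠ 0 := by linarith
    field_simp at this ⊢
    linarith
  have hx : 1 / l ^ 2 ≤ 1 := by
    rw [div_le_one (by positivity)]; nlinarith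
  have hx0 : 0 ≤ 1 / l ^ 2 := by positivity
  rw [e, norm_mul, hk']
  generalize 1 / l ^ 2 = x at *
  calc ‖v - w‖ * ‖1 + 1 / (v * w)‖ * (l * (1 - x)) ^ 2
      ≤ ‖v - w‖ * (1 + 2 * x) * (l * (1 - x)) ^ 2 := by gcongr
    _ = ‖v - w‖ * l ^ 2 * ((1 + 2 * x) * (1 - x) ^ 2) := by ring
    _ ≤ ‖v - w‖ * l ^ 2 * 1 := by
      gcongr
      -- With x = 1/l², (1 + 2x)(1 - x)² = 1 - 3x² + 2x³: the first-order terms cancel, which is why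
      -- the weight is the square of `lam`.
      nlinarith [mul_nonneg hx0 (sub_nonneg.2 hx), mul_nonneg (mul_nonneg hx0 hx0) (sub_nonneg.2 hx)]
    _ ≤ E := by linarith

/-- The same `E` serves at every level, so the bound is independent of `j`. The reference orbit
stays near `lam k`, which keeps the perturbed orbit away from 0 and hence finite. -/
theorem psi_iterate_error {m : ℕ} (hm : 8 ≤ lam m) {w : ℕ → ℂ}
    (hw : ∀ k, m ≤ k → ‖w k - lam k‖ ≤ 1)
    (hψ : ∀ k, m ≤ k → w k = w (k + 1) - 1 / w (k + 1)) {E : ℝ} (hE : E ≤ 1) (j : ℕ) {k : ℕ}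
    (hk : m ≤ k) {v : ℂ} (hv : ‖v - w (k + j)‖ * lam (k + j) ^ 2 ≤ E) :
    ∃ v' : ℂ, psi^[j] (v : OnePoint ℂ) = v' ∧ ‖v' - w k‖ * lam k ^ 2 ≤ E := by
  induction j generalizing v with
  | zero => exact ⟨v, rfl, hv⟩
  | succ j ih =>
    have h8 : 8 ≤ lam (k + j + 1) := hm.trans (lam_strictMono.monotone (by omega))
    obtain ⟨h0, h1⟩ := psi_error_step h8 (hw _ (by omega)) hE hv
    rw [← hψ _ (by omega)] at h1
    obtain ⟨v', h2, h3⟩ := ih h1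
    exact ⟨v', by rw [Function.iterate_succ_apply, psi_coe h0, h2], h3⟩

end FixedPointMeasure

/-! ### The Hausdorff moment problem and the fixed point measure -/

namespace FixedPointMeasure

open MeasureTheory Finset.HasAntidiagonal

/-- The backward difference operator on sequences. -/
def bdiff (x : ℕ → ℝ) (n : ℕ) : ℝ := x n - x (n + 1)

theorem bdiff_iterate_shift (k : ℕ) (x : ℕ → ℝ) (n : ℕ) :
    bdiff^[k] (fun n => x (n + 1)) n = bdiff^[k] x (n + 1) := by
  induction k generalizing n with
  | zero => rfl
  | succ k ih => simp only [Function.iterate_succ_apply', bdiff, ih]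

theorem bdiff_iterate_neg (k : ℕ) (x : ℕ → ℝ) (n : ℕ) :
    bdiff^[k] (fun n => -x n) n = -bdiff^[k] x n := by
  induction k generalizing n with
  | zero => rfl
  | succ k ih => simp only [Function.iterate_succ_apply', bdiff, ih]; ring

theorem bdiff_iterate_add (k : ℕ) (x y : ℕ → ℝ) (n : ℕ) :
    bdiff^[k] (fun n => x n + y n) n = bdiff^[k] x n + bdiff^[k] y n := by
  induction k generalizing n with
  | zero => rfl
  | succ k ih => simp only [Function.iterate_succ_apply', bdiff, ih]; ring

theorem bdiff_iterate_const (k : ℕ) (c : ℝ) (n : ℕ) :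
    bdiff^[k + 1] (fun _ => c) n = 0 := by
  induction k generalizing n with
  | zero => simp [bdiff]
  | succ k ih => rw [Function.iterate_succ_apply', bdiff, ih, ih, sub_zero]

/-- The Leibniz rule for iterated backward differences. -/
theorem bdiff_iterate_mul (k : ℕ) (x y : ℕ → ℝ) (n : ℕ) :
    bdiff^[k] (fun n => x n * y n) n = ∑ p ∈ antidiagonal k,
      (k.choose p.1 : ℝ) * (bdiff^[p.1] x (n + p.2) * bdiff^[p.2] y n) := by
  induction k generalizing x y n with
  | zero => simp
  | succ k ih =>
    have h : bdiff (fun n => x n * y n) =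
        fun n => bdiff x n * y n + x (n + 1) * bdiff y n := by
      funext n
      simp only [bdiff]
      ring
    rw [Function.iterate_succ_apply, h, bdiff_iterate_add, ih, ih (fun n => x (n + 1)),
      Finset.sum_antidiagonal_choose_succ_mul
        (fun i j => bdiff^[i] x (n + j) * bdiff^[j] y n), add_comm]
    congr 1
    · refine Finset.sum_congr rfl fun p _ => ?_
      rw [bdiff_iterate_shift, Function.iterate_succ_apply, add_assoc]
    · refine Finset.sum_congr rfl fun p hp => ?_
      rw [mem_antidiagonal] at hp
      rw [Function.iterate_succ_apply, Nat.choose_symm_of_eq_add hp.symm]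

theorem bdiff_iterate_lam (k n : ℕ) :
    bdiff^[k + 1] (fun n => lam (n + 1)) n = -bdiff^[k] (fun n => 1 / lam (n + 1)) (n + 1) := by
  rw [Function.iterate_succ_apply, ← bdiff_iterate_shift, ← bdiff_iterate_neg]
  refine congrArg (fun f => bdiff^[k] f n) (funext fun n => ?_)
  rw [bdiff, ← lam_succ_sub]
  ring

/-- The sequence `1 / lam (n + 1)` is completely monotone. -/
theorem bdiff_iterate_inv_lam_nonneg (k n : ℕ) :
    0 ≤ bdiff^[k] (fun n => 1 / lam (n + 1)) n := by
  induction k using Nat.strong_induction_on generalizing n with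
  | _ k ih =>
    rcases k with _ | k
    · exact (one_div_pos.2 (lam_succ_pos n)).le
    have h := bdiff_iterate_mul (k + 1) (fun n => 1 / lam (n + 1)) (fun n => lam (n + 1)) n
    have h1 : (fun n : ℕ => 1 / lam (n + 1) * lam (n + 1)) = fun _ => (1 : ℝ) := by
      funext n
      exact one_div_mul_cancel (lam_succ_pos n).ne'
    -- The Leibniz rule is applied to the constant product 1. The term split off is the desired
    -- difference times `lam (n + 1)`. In every other term a positive-order difference of `lam` is
    -- minus a lower-order difference of `1 / lam`, so induction makes the term nonpositive.
    rw [h1, bdiff_iterate_const, Finset.Nat.sum_antidiagonal_succ'] at h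
    have h2 : ∑ p ∈ antidiagonal k, ((k + 1).choose p.1 : ℝ) *
        (bdiff^[p.1] (fun n => 1 / lam (n + 1)) (n + (p.2 + 1)) *
          bdiff^[p.2 + 1] (fun n => lam (n + 1)) n) ≤ 0 := by
      refine Finset.sum_nonpos fun p hp => ?_
      rw [mem_antidiagonal] at hp
      rw [bdiff_iterate_lam]
      have := mul_nonneg (ih p.1 (by omega) (n + (p.2 + 1))) (ih p.2 (by omega) (n + 1))
      have := mul_nonneg (Nat.cast_nonneg (α := ℝ) ((k + 1).choose p.1)) this
      linarith
    simp only [Nat.choose_self, Nat.cast_one, one_mul, add_zero, Function.iterate_zero, id] at h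
    by_contra! hneg
    have := mul_neg_of_neg_of_pos hneg (lam_succ_pos n)
    linarith

/-- Shift plus `bdiff` is the identity, and this is the binomial expansion of its `N`-th power at 0.
It gives the total mass of the approximating measures. -/
theorem sum_choose_mul_bdiff (x : ℕ → ℝ) (N : ℕ) :
    ∑ p ∈ antidiagonal N, (N.choose p.1 : ℝ) * bdiff^[p.2] x p.1 = x 0 := by
  induction N with
  | zero => simp
  | succ N ih =>
    rw [Finset.sum_antidiagonal_choose_succ_mul (fun i j => bdiff^[j] x i), ← ih,
      ← Finset.sum_add_distrib]
    refine Finset.sum_congr rfl fun p hp => ?_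
    rw [mem_antidiagonal] at hp
    rw [Function.iterate_succ_apply', bdiff, Nat.choose_symm_of_eq_add hp.symm]
    ring

/-- These are the factorial moments of the Hausdorff weights, which are exact. The absorption
identity for binomial coefficients reduces `m + 1` to `m` for the shifted sequence. -/
theorem sum_choose_mul_descFactorial_mul_bdiff (m : ℕ) (x : ℕ → ℝ) (N : ℕ) :
    ∑ p ∈ antidiagonal N,
      (N.choose p.1 : ℝ) * bdiff^[p.2] x p.1 * (p.1.descFactorial m : ℝ) =
      N.descFactorial m * x m := by
  induction m generalizing x N with
  | zero => simpa using sum_choose_mul_bdiff x N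
  | succ m ih =>
    rcases N with _ | N
    · simp
    rw [Finset.Nat.sum_antidiagonal_succ, Nat.succ_descFactorial_succ]
    simp only [Nat.zero_descFactorial_succ, Nat.cast_zero, mul_zero, zero_add]
    have := ih (fun n => x (n + 1)) N
    push_cast at this ⊢
    rw [mul_assoc, ← this, Finset.mul_sum]
    refine Finset.sum_congr rfl fun p _ => ?_
    rw [bdiff_iterate_shift, Nat.succ_descFactorial_succ]
    have h : ((N + 1 : ℕ) : ℝ) * N.choose p.1 = (N + 1).choose (p.1 + 1) * (p.1 + 1 : ℕ) :=
      mod_cast Nat.add_one_mul_choose_eq N p.1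
    push_cast at h ⊢
    linear_combination -(bdiff^[p.2] x (p.1 + 1) * (p.1.descFactorial m : ℝ)) * h

/-- The moments of the discrete measures attached to a sequence converge to that sequence. -/
theorem tendsto_sum_choose_mul_bdiff (x : ℕ → ℝ) (j m : ℕ) :
    Tendsto (fun N : ℕ => ∑ p ∈ antidiagonal N, (N.choose p.1 : ℝ) * bdiff^[p.2] x p.1 *
      (((p.1 : ℝ) / N) ^ j * (p.1.descFactorial m / (N : ℝ) ^ m))) atTop (𝓝 (x (m + j))) := by
  induction j generalizing m with
  | zero =>
    have h : Tendsto (fun N : ℕ => (N.descFactorial m : ℝ) / (N : ℝ) ^ m * x m) atTop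
        (𝓝 (1 * x m)) := by
      refine Tendsto.mul_const _ ?_
      refine (Asymptotics.isEquivalent_iff_tendsto_one ?_).1 (isEquivalent_descFactorial m)
      filter_upwards [eventually_gt_atTop 0] with N hN
      positivity
    rw [one_mul] at h
    refine h.congr fun N => ?_
    rw [div_mul_eq_mul_div, ← sum_choose_mul_descFactorial_mul_bdiff, Finset.sum_div]
    refine Finset.sum_congr rfl fun p _ => ?_
    ring
  | succ j ih =>
    have h1 := ih (m + 1)
    have h2 := (tendsto_const_div_atTop_nhds_zero_nat (m : ℝ)).mul (ih m)
    have h3 := h1.add h2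
    rw [zero_mul, add_zero, show m + 1 + j = m + (j + 1) by ring] at h3
    refine h3.congr' ?_
    filter_upwards [eventually_gt_atTop 0] with N hN
    rw [Finset.mul_sum, ← Finset.sum_add_distrib]
    refine Finset.sum_congr rfl fun p _ => ?_
    have hN' : (N : ℝ) ≠ 0 := by positivity
    -- This trades a power of i/N for a falling factorial: i·(i)_m = (i)_{m+1} + m·(i)_m, where the
    -- last term acquires a factor m/N and vanishes in the limit.
    have h4 : (p.1.descFactorial (m + 1) : ℝ) = (p.1 - m) * p.1.descFactorial m := by
      rw [Nat.descFactorial_succ]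
      push_cast
      rcases le_or_gt m p.1 with h | h
      · rw [Nat.cast_sub h]
      · simp [Nat.descFactorial_eq_zero_iff_lt.2 h]
    rw [h4, pow_succ ((p.1 : ℝ) / N)]
    generalize ((p.1 : ℝ) / N) ^ j = A
    field_simp
    ring

theorem tendsto_moment_of_tendsto {ι : Type*} {F : Filter ι} {ν : ι → ProbabilityMeasure unitInterval}
    {μ : ProbabilityMeasure unitInterval} (h : Tendsto ν F (𝓝 μ)) (n : ℕ) :
    Tendsto (fun i => moment (ν i) n) F (𝓝 (moment μ n)) :=
  ProbabilityMeasure.tendsto_iff_forall_integral_tendsto.1 h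
    (BoundedContinuousFunction.mkOfCompact ⟨fun t : unitInterval => (t : ℝ) ^ n, by fun_prop⟩)

/-- Hausdorff's theorem: a completely monotone sequence is a moment sequence on `[0,1]`. -/
theorem exists_moment_eq {x : ℕ → ℝ} (h0 : x 0 = 1) (hx : ∀ k n, 0 ≤ bdiff^[k] x n) :
    ∃ μ : ProbabilityMeasure unitInterval, ∀ n, moment μ n = x n := by
  set w : ℕ → ℕ × ℕ → ℝ := fun N p => N.choose p.1 * bdiff^[p.2] x p.1 with hw
  have hw0 : ∀ N p, 0 ≤ w N p := fun N p => mul_nonneg (Nat.cast_nonneg _) (hx _ _)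
  let pt : ℕ → ℕ → unitInterval := fun N i => Set.projIcc 0 1 zero_le_one ((i : ℝ) / N)
  let ν : ℕ → Measure unitInterval := fun N =>
    ∑ p ∈ antidiagonal N, ENNReal.ofReal (w N p) • Measure.dirac (pt N p.1)
  have hν : ∀ N, IsProbabilityMeasure (ν N) := fun N => by
    constructor
    simp only [ν, Measure.coe_finsetSum, Finset.sum_apply, Measure.smul_apply, measure_univ,
      smul_eq_mul, mul_one]
    rw [← ENNReal.ofReal_sum_of_nonneg fun p _ => hw0 N p, sum_choose_mul_bdiff, h0,
      ENNReal.ofReal_one]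
  have hmom : ∀ N n, moment (ν N) n =
      ∑ p ∈ antidiagonal N, w N p * (((p.1 : ℝ) / N) ^ n) := by
    intro N n
    have hint : ∀ κ : Measure unitInterval, IsFiniteMeasure κ →
        Integrable (fun t : unitInterval => (t : ℝ) ^ n) κ := fun κ _ =>
      Continuous.integrable_of_hasCompactSupport (by fun_prop)
        (HasCompactSupport.of_compactSpace _)
    rw [moment, integral_finsetSum_measure]
    · refine Finset.sum_congr rfl fun p hp => ?_
      rw [mem_antidiagonal] at hp
      rw [integral_smul_measure, integral_dirac, ENNReal.toReal_ofReal (hw0 N p), smul_eq_mul]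
      congr 2
      refine congrArg Subtype.val (Set.projIcc_of_mem zero_le_one ⟨by positivity, ?_⟩)
      exact div_le_one_of_le₀ (by exact_mod_cast (by omega)) (by positivity)
    · intro p _
      exact (hint _ inferInstance).smul_measure ENNReal.ofReal_ne_top
  let P : ℕ → ProbabilityMeasure unitInterval := fun N => ⟨ν N, hν N⟩
  have : Nonempty (ProbabilityMeasure unitInterval) := ⟨P 0⟩
  -- Probability measures on the compact interval form a compact space, so the approximations
  -- converge along an ultrafilter; no subsequence is needed.
  let U : Ultrafilter ℕ := Ultrafilter.of atTop
  have hU : Tendsto P U (𝓝 (U.map P).lim) := (U.map P).le_nhds_lim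
  refine ⟨(U.map P).lim, fun n => ?_⟩
  refine tendsto_nhds_unique (tendsto_moment_of_tendsto hU n) ?_
  have h1 := (tendsto_sum_choose_mul_bdiff x n 0).mono_left (Ultrafilter.of_le (atTop : Filter ℕ))
  rw [zero_add] at h1
  refine h1.congr fun N => ?_
  rw [show moment (P N) n = _ from hmom N n]
  simp [hw]

/-- Finite measures on `[0,1]` are determined by their moments. -/
theorem measure_eq_of_moment_eq {μ ν : Measure unitInterval} [IsFiniteMeasure μ]
    [IsFiniteMeasure ν] (h : ∀ n, moment μ n = moment ν n) : μ = ν := by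
  have hint : ∀ (κ : Measure unitInterval) [IsFiniteMeasure κ] (g : C(unitInterval, ℝ)),
      Integrable g κ := fun κ _ g =>
    g.continuous.integrable_of_hasCompactSupport (HasCompactSupport.of_compactSpace _)
  have hcont : ∀ (κ : Measure unitInterval) [IsFiniteMeasure κ],
      Continuous fun g : C(unitInterval, ℝ) => ∫ t, g t ∂κ := fun κ _ => by
    have := (ContinuousMap.toLp (p := 1) (𝕜 := ℝ) κ (E := ℝ)).continuous
    refine (continuous_integral.comp this).congr fun g => ?_
    exact integral_congr_ae (ContinuousMap.coeFn_toLp κ g)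
  have hpoly : ∀ p : Polynomial ℝ, ∫ t : unitInterval, p.eval (t : ℝ) ∂μ =
      ∫ t : unitInterval, p.eval (t : ℝ) ∂ν := by
    intro p
    have hexp : ∀ (κ : Measure unitInterval) [IsFiniteMeasure κ],
        ∫ t : unitInterval, p.eval (t : ℝ) ∂κ = ∑ i ∈ p.support, p.coeff i * moment κ i := by
      intro κ _
      simp only [Polynomial.eval_eq_sum, Polynomial.sum]
      rw [integral_finsetSum]
      · exact Finset.sum_congr rfl fun i _ => integral_const_mul _ _
      · intro i _
        exact hint κ ⟨fun t : unitInterval => p.coeff i * (t : ℝ) ^ i, by fun_prop⟩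
    rw [hexp, hexp]
    simp only [h]
  have hall : ∀ g : C(unitInterval, ℝ), ∫ t, g t ∂μ = ∫ t, g t ∂ν := by
    have hclosed := isClosed_eq (hcont μ) (hcont ν)
    intro g
    have hg : g ∈ (polynomialFunctions unitInterval).topologicalClosure := by
      rw [polynomialFunctions.topologicalClosure]; trivial
    refine closure_minimal ?_ hclosed hg
    rintro _ ⟨p, -, rfl⟩
    exact hpoly p
  exact ext_of_forall_integral_eq_of_IsFiniteMeasure fun f => hall f.toContinuousMap

/-- If the earlier moments sum to `lam (n + 1)`, the next one is the nonnegative root of y(λ_{n+1} +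
y) = 1, namely λ_{n+2} - λ_{n+1}. -/
theorem isFixedPointMeasure_iff_moment {μ : Measure unitInterval} [IsProbabilityMeasure μ] :
    IsFixedPointMeasure μ ↔ ∀ n, moment μ n = 1 / lam (n + 1) := by
  constructor
  · intro h n
    induction n using Nat.strong_induction_on with
    | _ n ih =>
      rcases n with _ | n
      · simp [moment]
      have hT := congrFun h.fixed (n + 1)
      have hs : ∑ k ∈ Finset.range (n + 1), moment μ k = lam (n + 1) := by
        rw [← sum_inv_lam]
        exact Finset.sum_congr rfl fun k hk => ih k (by simpa using hk)
      rw [T, Finset.sum_range_succ, hs] at hT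
      have hl := lam_succ_mul_sub (n + 1)
      have hp := lam_succ_pos (n + 1)
      have hp' := lam_succ_pos n
      set y := moment μ (n + 1)
      have hy0 : 0 ≤ y := integral_nonneg fun t => pow_nonneg t.2.1 _
      have hy : y * (lam (n + 1) + y) = 1 := by
        have := one_div_mul_cancel (add_pos_of_pos_of_nonneg hp' hy0).ne'
        rwa [hT] at this
      rw [← lam_succ_sub]
      nlinarith
  · intro h
    refine ⟨inferInstance, ?_⟩
    funext n
    rw [T, h n, Finset.sum_congr rfl fun k _ => h k, sum_inv_lam]

theorem existsUnique_isFixedPointMeasure :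
    ∃! μ : Measure unitInterval, IsFixedPointMeasure μ := by
  obtain ⟨μ, hμ⟩ := exists_moment_eq (x := fun n => 1 / lam (n + 1)) (by simp)
    bdiff_iterate_inv_lam_nonneg
  have hfix : IsFixedPointMeasure μ := isFixedPointMeasure_iff_moment.2 hμ
  refine ⟨μ, hfix, fun ν hν => ?_⟩
  have := hν.isProbabilityMeasure
  refine measure_eq_of_moment_eq fun n => ?_
  rw [hμ, isFixedPointMeasure_iff_moment.1 hν]

end FixedPointMeasure

/-! ### The functional equation of the Bernstein transform -/

namespace FixedPointMeasure

open MeasureTheory unitInterval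

/-- The Mellin-type transform `z ↦ ∫ t^z dν(t)` of a measure on `[0,1]`. -/
noncomputable def power (ν : Measure unitInterval) (z : ℂ) : ℂ := ∫ t, ((t : ℝ) : ℂ) ^ z ∂ν

theorem power_natCast (ν : Measure unitInterval) (n : ℕ) : power ν n = moment ν n := by
  rw [power, moment, ← integral_complex_ofReal]
  refine integral_congr_ae (Eventually.of_forall fun t => ?_)
  simp [Complex.cpow_natCast]

theorem continuous_unitInterval_cpow {z : ℂ} (hz : 0 < z.re) :
    Continuous fun t : unitInterval => ((t : ℝ) : ℂ) ^ z :=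
  (Complex.continuous_ofReal_cpow_const hz).comp continuous_subtype_val

theorem integrable_of_continuous_of_compactSpace {X : Type*} [TopologicalSpace X] [CompactSpace X]
    [MeasurableSpace X] [OpensMeasurableSpace X] (ν : Measure X) [IsFiniteMeasure ν]
    {g : X → ℂ} (hg : Continuous g) : Integrable g ν :=
  hg.integrable_of_hasCompactSupport (HasCompactSupport.of_compactSpace _)

/-- For Re w > 1 the derivative of the integrand is bounded by t|log t| < 1, so the constant 1
dominates. -/
theorem differentiableAt_power (ν : Measure unitInterval) [IsFiniteMeasure ν] {z : ℂ}
    (hz : 1 < z.re) : DifferentiableAt ℂ (power ν) z := by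
  have hopen : IsOpen {w : ℂ | 1 < w.re} := isOpen_lt continuous_const Complex.continuous_re
  refine (hasDerivAt_integral_of_dominated_loc_of_deriv_le (bound := fun _ => 1)
    (F' := fun w (t : unitInterval) => ((t : ℝ) : ℂ) ^ w * Complex.log (t : ℝ))
    (hopen.mem_nhds hz) ?_ ?_ ?_ ?_ (integrable_const _) ?_).2.differentiableAt
  · filter_upwards [hopen.mem_nhds hz] with w hw
    exact (continuous_unitInterval_cpow (zero_lt_one.trans hw)).aestronglyMeasurable
  · exact integrable_of_continuous_of_compactSpace ν
      (continuous_unitInterval_cpow (zero_lt_one.trans hz))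
  · exact (by fun_prop : Measurable fun t : unitInterval =>
      ((t : ℝ) : ℂ) ^ z * Complex.log (t : ℝ)).aestronglyMeasurable
  · refine Eventually.of_forall fun t w hw => ?_
    rcases t.2.1.eq_or_lt with h0 | h0
    · simp [← h0]
    rw [norm_mul, Complex.norm_cpow_eq_rpow_re_of_pos h0, ← Complex.ofReal_log h0.le,
      Complex.norm_real, Real.norm_eq_abs]
    have h1 : (t : ℝ) ^ w.re ≤ t := by
      simpa using Real.rpow_le_rpow_of_exponent_ge h0 t.2.2 (le_of_lt hw)
    have h2 := Real.abs_log_mul_self_lt t h0 t.2.2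
    rw [abs_mul, abs_of_pos h0] at h2
    nlinarith [abs_nonneg (Real.log t)]
  · refine Eventually.of_forall fun t w hw => ?_
    have hw0 : w ≠ 0 := by
      rintro rfl
      simp at hw
      linarith
    simpa using (hasDerivAt_id w).const_cpow (c := ((t : ℝ) : ℂ)) (Or.inr hw0)

theorem integral_unitInterval (g : ℝ → ℂ) :
    ∫ s : unitInterval, g s = ∫ x in (0 : ℝ)..1, g x := by
  rw [unitInterval.measurePreserving_coe.integral_comp unitInterval.measurableEmbedding_coe,
    intervalIntegral.integral_of_le zero_le_one, ← integral_Icc_eq_integral_Ioc]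

/-- The point σ(σt·σs) is t + (1-t)s, so the integral is the mean of y^z over [t, 1]. This exhibits
the Bernstein kernel as a power integral. -/
theorem integral_cpow_eq_bernsteinKernel {z : ℂ} (hz : 0 < z.re) (t : unitInterval) :
    ∫ s : unitInterval, (((σ (σ t * σ s) : unitInterval) : ℝ) : ℂ) ^ z =
      bernsteinKernel (z + 1) t / (z + 1) := by
  have hz1 : z + 1 ≠ 0 := fun h => by
    have := congrArg Complex.re h
    simp at this
    linarith
  rcases eq_or_ne (t : ℝ) 1 with ht | ht
  · simp [bernsteinKernel, ht, unitInterval.coe_symm_eq, div_self hz1]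
  have ht' : 1 - (t : ℝ) ≠ 0 := sub_ne_zero.2 ht.symm
  have h1 : ∀ s : unitInterval, (((σ (σ t * σ s) : unitInterval) : ℝ) : ℂ) ^ z =
      (fun x : ℝ => (fun y : ℝ => (y : ℂ) ^ z) ((1 - (t : ℝ)) * x + t)) s := by
    intro s
    simp only [unitInterval.coe_symm_eq, Set.Icc.coe_mul]
    congr 2
    ring
  rw [integral_congr_ae (Eventually.of_forall h1),
    integral_unitInterval (fun x : ℝ => (fun y : ℝ => (y : ℂ) ^ z) ((1 - (t : ℝ)) * x + t)),
    intervalIntegral.integral_comp_mul_add (fun y : ℝ => (y : ℂ) ^ z) ht',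
    integral_cpow (Or.inl (by linarith))]
  have ht'' : 1 - ((t : ℝ) : ℂ) ≠ 0 := mod_cast ht'
  rw [bernsteinKernel, if_neg ht]
  simp only [mul_zero, zero_add, mul_one, sub_add_cancel, Complex.ofReal_one, Complex.one_cpow,
    Complex.real_smul, Complex.ofReal_inv, Complex.ofReal_sub]
  field_simp

theorem continuous_interpolate_cpow {z : ℂ} (hz : 0 < z.re) :
    Continuous fun p : unitInterval × unitInterval =>
      (((σ (σ p.1 * σ p.2) : unitInterval) : ℝ) : ℂ) ^ z :=
  (continuous_unitInterval_cpow hz).comp (by fun_prop)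

variable {μ : Measure unitInterval} [IsProbabilityMeasure μ]

theorem bernsteinKernel_add_one_sub {z : ℂ} (hz : 0 < z.re) (t : unitInterval) :
    bernsteinKernel (z + 1) t - bernsteinKernel z t = ((t : ℝ) : ℂ) ^ z := by
  have hz0 : z ≠ 0 := by rintro rfl; simp at hz
  rcases eq_or_ne (t : ℝ) 1 with ht | ht
  · simp [bernsteinKernel, ht]
  have ht' : 1 - ((t : ℝ) : ℂ) ≠ 0 := mod_cast sub_ne_zero.2 ht.symm
  rw [bernsteinKernel, bernsteinKernel, if_neg ht, if_neg ht]
  have h : ((t : ℝ) : ℂ) ^ (z + 1) = ((t : ℝ) : ℂ) ^ z * (t : ℝ) := by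
    rcases eq_or_ne ((t : ℝ) : ℂ) 0 with h0 | h0
    · have hz1 : z + 1 ≠ 0 := fun h => by
        have := congrArg Complex.re h
        simp at this
        linarith
      rw [h0, Complex.zero_cpow hz1, mul_zero]
    · rw [Complex.cpow_add _ _ h0, Complex.cpow_one]
  rw [h]
  field_simp
  ring

/-- The kernel at z + 1 is a multiple of a partial integral of a jointly continuous function, so
Fubini gives its integrability. Subtracting t^z brings it down to z. -/
theorem integrable_bernsteinKernel {z : ℂ} (hz : 0 < z.re) :
    Integrable (fun t : unitInterval => bernsteinKernel z t) μ := by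
  have hz1 : z + 1 ≠ 0 := fun h => by
    have := congrArg Complex.re h
    simp at this
    linarith
  have h1 := (integrable_of_continuous_of_compactSpace (μ.prod volume)
    (continuous_interpolate_cpow hz)).integral_prod_left
  simp only [integral_cpow_eq_bernsteinKernel hz] at h1
  have h2 := (h1.mul_const (z + 1)).sub
    (integrable_of_continuous_of_compactSpace μ (continuous_unitInterval_cpow hz))
  refine h2.congr (Eventually.of_forall fun t => ?_)
  simp only [Pi.sub_apply]
  rw [div_mul_cancel₀ _ hz1, ← bernsteinKernel_add_one_sub hz]
  ring

theorem bernstein_add_one {z : ℂ} (hz : 0 < z.re) :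
    bernstein μ (z + 1) = bernstein μ z + power μ z := by
  have hz' : 0 < (z + 1).re := by simp; linarith
  rw [eq_comm, add_comm, ← eq_sub_iff_add_eq, bernstein, bernstein, power,
    ← integral_sub (integrable_bernsteinKernel hz') (integrable_bernsteinKernel hz)]
  exact integral_congr_ae (Eventually.of_forall fun t => (bernsteinKernel_add_one_sub hz t).symm)

theorem bernstein_one : bernstein μ 1 = 1 := by
  have h : ∀ t : unitInterval, bernsteinKernel 1 t = 1 := by
    intro t
    rcases eq_or_ne (t : ℝ) 1 with ht | ht
    · simp [bernsteinKernel, ht]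
    have ht' : 1 - ((t : ℝ) : ℂ) ≠ 0 := mod_cast sub_ne_zero.2 ht.symm
    rw [bernsteinKernel, if_neg ht, Complex.cpow_one, div_self ht']
  simp [bernstein, h]

/-- The image of `μ ⊗ volume` under a random convex combination with `1`. -/
noncomputable def interpolate (μ : Measure unitInterval) : Measure unitInterval :=
  (μ.prod volume).map fun p => σ (σ p.1 * σ p.2)

instance : IsProbabilityMeasure (interpolate μ) :=
  Measure.isProbabilityMeasure_map (Continuous.aemeasurable (by fun_prop))

theorem power_interpolate {z : ℂ} (hz : 0 < z.re) :
    power (interpolate μ) z = bernstein μ (z + 1) / (z + 1) := by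
  rw [power, interpolate, integral_map (Continuous.aemeasurable (by fun_prop))
    (continuous_unitInterval_cpow hz).aestronglyMeasurable,
    integral_prod _ (integrable_of_continuous_of_compactSpace _ (continuous_interpolate_cpow hz))]
  simp only [integral_cpow_eq_bernsteinKernel hz]
  rw [integral_div, bernstein]

theorem differentiableAt_bernstein {z : ℂ} (hz : 2 < z.re) :
    DifferentiableAt ℂ (bernstein μ) z := by
  have hopen : IsOpen {w : ℂ | 2 < w.re} := isOpen_lt continuous_const Complex.continuous_re
  have h : DifferentiableAt ℂ (fun w => power (interpolate μ) (w - 1) * w) z := by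
    refine DifferentiableAt.mul ?_ differentiableAt_id
    refine DifferentiableAt.comp (g := power (interpolate μ)) z (differentiableAt_power _ ?_)
      (differentiableAt_id.sub_const 1)
    simp
    linarith
  refine h.congr_of_eventuallyEq ?_
  filter_upwards [hopen.mem_nhds hz] with w hw
  have hw' : 2 < w.re := hw
  have hw0 : w ≠ 0 := by
    rintro rfl
    simp at hw'
    linarith
  rw [power_interpolate (by simp; linarith), sub_add_cancel, div_mul_cancel₀ _ hw0]

/-- Multiplicative convolution becomes a product because (st)^z = s^z t^z for nonnegative reals. -/
theorem power_mul_map (ν κ : Measure unitInterval) [IsProbabilityMeasure ν]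
    [IsProbabilityMeasure κ] {z : ℂ} (hz : 0 < z.re) :
    power ((ν.prod κ).map fun p => p.1 * p.2) z = power ν z * power κ z := by
  rw [power, integral_map (Continuous.aemeasurable (by fun_prop))
    (continuous_unitInterval_cpow hz).aestronglyMeasurable, power, power, ← integral_prod_mul]
  refine integral_congr_ae (Eventually.of_forall fun p => ?_)
  simp only [Set.Icc.coe_mul, Complex.ofReal_mul]
  exact Complex.mul_cpow_ofReal_nonneg p.1.2.1 p.2.2.1 z

theorem power_volume {z : ℂ} (hz : 0 < z.re) :
    power (volume : Measure unitInterval) z = 1 / (z + 1) := by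
  have hz1 : z + 1 ≠ 0 := fun h => by
    have := congrArg Complex.re h
    simp at this
    linarith
  rw [power, integral_unitInterval (fun x => (x : ℂ) ^ z), integral_cpow (Or.inl (by linarith))]
  simp [Complex.zero_cpow hz1]

theorem bernstein_natCast (hm : ∀ n, moment μ n = 1 / lam (n + 1)) (n : ℕ) : bernstein μ ((n + 1 : ℕ) : ℂ) = lam (n + 1) := by
  induction n with
  | zero => simp [bernstein_one]
  | succ n ih =>
    rw [Nat.cast_succ, bernstein_add_one (by simp; positivity), ih, power_natCast, hm,
      ← lam_succ_sub]
    push_cast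
    ring

/-- The convolution of `μ` with its interpolation is Lebesgue measure. -/
theorem map_mul_interpolate (hm : ∀ n, moment μ n = 1 / lam (n + 1)) :
    (μ.prod (interpolate μ)).map (fun p => p.1 * p.2) = (volume : Measure unitInterval) := by
  have hP : IsProbabilityMeasure ((μ.prod (interpolate μ)).map (fun p => p.1 * p.2)) :=
    Measure.isProbabilityMeasure_map (Continuous.aemeasurable (by fun_prop))
  -- At a positive integer n the product of transforms is (1/λ_{n+1})·(λ_{n+1}/(n+1)) = 1/(n+1).
  -- Determinacy of measures is what carries the integer identity over to complex exponents.
  refine measure_eq_of_moment_eq fun n => ?_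
  rcases n with _ | n
  · simp [moment]
  have hre : 0 < (((n + 1 : ℕ) : ℂ)).re := by
    rw [Complex.natCast_re]
    positivity
  have h := bernstein_natCast hm (n + 1)
  rw [← Complex.ofReal_inj, ← power_natCast, ← power_natCast, power_mul_map _ _ hre,
    power_volume hre, power_interpolate hre, power_natCast, hm, ← Nat.cast_succ,
    Nat.succ_eq_add_one, h]
  have h0 : (lam (n + 1 + 1) : ℂ) ≠ 0 := mod_cast (lam_succ_pos _).ne'
  push_cast
  field_simp

theorem bernstein_mul_power (hm : ∀ n, moment μ n = 1 / lam (n + 1))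
    {z : ℂ} (hz : 0 < z.re) :
    bernstein μ (z + 1) * power μ z = 1 := by
  have hz1 : z + 1 ≠ 0 := fun h => by
    have := congrArg Complex.re h
    simp at this
    linarith
  have h := power_mul_map μ (interpolate μ) hz
  rw [map_mul_interpolate hm, power_volume hz, power_interpolate hz] at h
  field_simp at h
  rw [mul_comm, ← h]

theorem bernstein_add_one_ne_zero (hm : ∀ n, moment μ n = 1 / lam (n + 1))
    {z : ℂ} (hz : 0 < z.re) : bernstein μ (z + 1) ≠ 0 :=
  left_ne_zero_of_mul_eq_one (bernstein_mul_power hm hz)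

/-- The functional equation of the Bernstein transform of the fixed point measure. -/
theorem bernstein_eq_sub_inv (hm : ∀ n, moment μ n = 1 / lam (n + 1))
    {z : ℂ} (hz : 0 < z.re) :
    bernstein μ z = bernstein μ (z + 1) - 1 / bernstein μ (z + 1) := by
  have h := bernstein_mul_power hm hz
  have h1 : 1 / bernstein μ (z + 1) = power μ z := by
    rw [div_eq_iff (bernstein_add_one_ne_zero hm hz), mul_comm, h]
  rw [h1, bernstein_add_one hz, add_sub_cancel_right]

end FixedPointMeasure

/-! ### Asymptotics of `bernstein μ (z + n)`, `a n z` and `b n z` -/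

namespace FixedPointMeasure

open MeasureTheory unitInterval

theorem norm_exp_sub_one_sub_le (x : ℂ) :
    ‖Complex.exp x - 1 - x‖ ≤ ‖x‖ ^ 2 * Real.exp ‖x‖ := by
  have h := Complex.norm_exp_sub_sum_le_norm_mul_exp x 2
  simpa [Finset.sum_range_succ, sub_sub] using h

/-- With u = -log t, t^z = exp(-uz) is expanded to first order, and u is replaced by 1 - t at
second-order cost. The factor `t ^ (R + 2)` absorbs exp(uR) = t^{-R} and the t⁻² in u² ≤ (1-t)²/t².
-/
theorem norm_one_sub_cpow_sub_le {R : ℕ} {z : ℂ} (hz : ‖z‖ ≤ R) {t : ℝ} (h0 : 0 < t)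
    (h1 : t ≤ 1) :
    ‖1 - (t : ℂ) ^ z - z * (1 - t)‖ * t ^ (R + 2) ≤ (R ^ 2 + R) * (1 - t) ^ 2 := by
  set u := -Real.log t with hu
  have hu0 : 0 ≤ u := neg_nonneg.2 (Real.log_nonpos h0.le h1)
  have hut : u * t ≤ 1 - t := by
    have h := Real.log_le_sub_one_of_pos (inv_pos.2 h0)
    rw [Real.log_inv] at h
    calc u * t ≤ (t⁻¹ - 1) * t := by gcongr
      _ = 1 - t := by field_simp
  have hu1 : 1 - t ≤ u := by
    have := Real.log_le_sub_one_of_pos h0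
    linarith
  have hpow : (t : ℂ) ^ z = Complex.exp (-(u * z)) := by
    rw [Complex.cpow_def_of_ne_zero (mod_cast h0.ne'), ← Complex.ofReal_log h0.le, hu]
    push_cast
    ring_nf
  have hnorm : ‖-((u : ℂ) * z)‖ ≤ u * R := by
    rw [norm_neg, norm_mul, Complex.norm_real, Real.norm_of_nonneg hu0]
    gcongr
  have hexp : Real.exp (u * R) * t ^ R = 1 := by
    rw [mul_comm u, Real.exp_nat_mul, hu, Real.exp_neg, Real.exp_log h0, ← mul_pow,
      inv_mul_cancel₀ h0.ne', one_pow]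
  have h2 : ‖1 - (t : ℂ) ^ z - z * (1 - t)‖ ≤
      (u * R) ^ 2 * Real.exp (u * R) + R * (u - (1 - t)) := by
    have e : 1 - (t : ℂ) ^ z - z * (1 - t) =
        -(Complex.exp (-(u * z)) - 1 - -(u * z)) + z * ((u - (1 - t) : ℝ) : ℂ) := by
      rw [hpow]
      push_cast
      ring
    rw [e]
    refine (norm_add_le _ _).trans (add_le_add ?_ ?_)
    · rw [norm_neg]
      refine (norm_exp_sub_one_sub_le _).trans ?_
      gcongr
    · rw [norm_mul, Complex.norm_real, Real.norm_of_nonneg (by linarith)]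
      gcongr
  have h3 : (u - (1 - t)) * t ≤ (1 - t) ^ 2 := by nlinarith
  have h4 : (u * t) ^ 2 ≤ (1 - t) ^ 2 := by gcongr
  calc ‖1 - (t : ℂ) ^ z - z * (1 - t)‖ * t ^ (R + 2)
      ≤ ((u * R) ^ 2 * Real.exp (u * R) + R * (u - (1 - t))) * t ^ (R + 2) := by gcongr
    _ = R ^ 2 * (u * t) ^ 2 * (Real.exp (u * R) * t ^ R) +
        R * ((u - (1 - t)) * t) * t ^ (R + 1) := by ring
    _ ≤ R ^ 2 * (1 - t) ^ 2 * 1 + R * (1 - t) ^ 2 * 1 := by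
      rw [hexp]
      gcongr
      exact pow_le_one₀ h0.le h1
    _ = (R ^ 2 + R) * (1 - t) ^ 2 := by ring

/-- Of the exponent q + R + 2, the part R + 2 pays for the previous bound. What remains after
division by 1 - t is (1-t)t^q, which integrates to a difference of consecutive moments. -/
theorem norm_bernsteinKernel_sub_le {R q : ℕ} (hq : 0 < q) {z : ℂ} (hz : ‖z‖ ≤ R)
    (t : unitInterval) :
    ‖bernsteinKernel (z + (q + R + 2 : ℕ)) t - bernsteinKernel (q + R + 2 : ℕ) t -
      z * ((t : ℝ) : ℂ) ^ (q + R + 2)‖ ≤ (R ^ 2 + R) * ((t : ℝ) ^ q - (t : ℝ) ^ (q + 1)) := by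
  rcases eq_or_ne (t : ℝ) 1 with ht | ht
  · simp [bernsteinKernel, ht]
  have ht1 : 0 < 1 - (t : ℝ) := sub_pos.2 (lt_of_le_of_ne t.2.2 ht)
  have ht' : 1 - ((t : ℝ) : ℂ) ≠ 0 := mod_cast ht1.ne'
  have hn0 : ((q + R + 2 : ℕ) : ℂ) ≠ 0 := Nat.cast_ne_zero.2 (by omega)
  have hzn : z + (q + R + 2 : ℕ) ≠ 0 := by
    intro h
    have h1 : z = -((q + R + 2 : ℕ) : ℂ) := eq_neg_of_add_eq_zero_left h
    rw [h1, norm_neg, Complex.norm_natCast] at hz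
    have : q + R + 2 ≤ R := by exact_mod_cast hz
    omega
  rw [bernsteinKernel, bernsteinKernel, if_neg ht, if_neg ht]
  rcases t.2.1.eq_or_lt with h0 | h0
  · rw [← h0]
    simp only [Complex.ofReal_zero, Complex.zero_cpow hn0, Complex.zero_cpow hzn]
    simp [hq.ne']
  have h0' : ((t : ℝ) : ℂ) ≠ 0 := mod_cast h0.ne'
  rw [Complex.cpow_add _ _ h0', Complex.cpow_natCast]
  have e : (1 - ((t : ℝ) : ℂ) ^ z * ((t : ℝ) : ℂ) ^ (q + R + 2)) / (1 - ((t : ℝ) : ℂ)) -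
      (1 - ((t : ℝ) : ℂ) ^ (q + R + 2)) / (1 - ((t : ℝ) : ℂ)) - z * ((t : ℝ) : ℂ) ^ (q + R + 2) =
      (1 - ((t : ℝ) : ℂ) ^ z - z * (1 - (t : ℝ))) * ((t : ℝ) : ℂ) ^ (q + R + 2) /
        (1 - (t : ℝ) : ℝ) := by
    push_cast
    field_simp
    ring
  rw [e, norm_div, norm_mul, norm_pow, Complex.norm_real, Complex.norm_real,
    Real.norm_of_nonneg ht1.le, Real.norm_of_nonneg h0.le, div_le_iff₀ ht1]
  have h := mul_le_mul_of_nonneg_right (norm_one_sub_cpow_sub_le hz h0 t.2.2)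
    (pow_nonneg h0.le q)
  calc _ = ‖1 - ((t : ℝ) : ℂ) ^ z - z * (1 - (t : ℝ))‖ * (t : ℝ) ^ (R + 2) * (t : ℝ) ^ q := by ring
    _ ≤ _ := h
    _ = _ := by ring

theorem inv_lam_sub_inv_lam (k : ℕ) :
    1 / lam (k + 1) - 1 / lam (k + 2) = 1 / (lam (k + 1) * lam (k + 2) ^ 2) := by
  have h := lam_succ_mul_sub (k + 1)
  have h1 := (lam_succ_pos k).ne'
  have h2 := (lam_succ_pos (k + 1)).ne'
  field_simp
  linear_combination h

theorem inv_lam_sub_inv_lam_le (k : ℕ) :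
    1 / lam (k + 1) - 1 / lam (k + 2) ≤ 1 / lam (k + 1) ^ 3 := by
  have h1 := lam_succ_pos k
  have h2 := (lam_lt_succ (k + 1)).le
  rw [inv_lam_sub_inv_lam, pow_succ' _ 2]
  gcongr

theorem norm_bernstein_add_natCast_sub_le {μ : Measure unitInterval} [IsProbabilityMeasure μ]
    (hm : ∀ n, moment μ n = 1 / lam (n + 1)) {R n : ℕ} (hn : R + 3 ≤ n)
    (hl : 2 * (R + 1) ≤ lam n) {z : ℂ} (hz : ‖z‖ ≤ R) :
    ‖bernstein μ (z + n) - lam n - z / lam n‖ ≤ (8 * (R ^ 2 + R) + R) / lam n ^ 3 := by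
  obtain ⟨q, hq, rfl⟩ : ∃ q, 0 < q ∧ n = q + R + 2 := ⟨n - (R + 2), by omega, by omega⟩
  have hre : 0 < (z + (q + R + 2 : ℕ)).re := by
    have h1 := (abs_le.1 (Complex.abs_re_le_norm z)).1
    rw [Complex.add_re, Complex.natCast_re]
    push_cast
    linarith [Nat.cast_nonneg (α := ℝ) q]
  have hre' : 0 < (((q + R + 2 : ℕ) : ℂ)).re := by
    rw [Complex.natCast_re]
    positivity
  have hint : ∀ k : ℕ, Integrable (fun t : unitInterval => (t : ℝ) ^ k) μ := fun k =>
    Continuous.integrable_of_hasCompactSupport (by fun_prop) (HasCompactSupport.of_compactSpace _)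
  have hintc : ∀ k : ℕ, Integrable (fun t : unitInterval => ((t : ℝ) : ℂ) ^ k) μ := fun k =>
    integrable_of_continuous_of_compactSpace _ (by fun_prop)
  have hmc : ∫ t : unitInterval, ((t : ℝ) : ℂ) ^ (q + R + 2) ∂μ = 1 / lam (q + R + 2 + 1) := by
    have h := power_natCast μ (q + R + 2)
    simp only [power, Complex.cpow_natCast] at h
    rw [h, hm]
    push_cast
    rfl
  have hmain : ‖bernstein μ (z + (q + R + 2 : ℕ)) - lam (q + R + 2) -
      z * (1 / lam (q + R + 2 + 1))‖ ≤ (R ^ 2 + R) * (1 / lam (q + 1) - 1 / lam (q + 2)) := by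
    have hb := bernstein_natCast hm (q + R + 1)
    have hsub : Integrable (fun t : unitInterval => bernsteinKernel (z + (q + R + 2 : ℕ)) t -
        bernsteinKernel (q + R + 2 : ℕ) t) μ :=
      (integrable_bernsteinKernel hre).sub (integrable_bernsteinKernel hre')
    rw [← hmc, ← hb, bernstein, bernstein, ← integral_const_mul,
      ← integral_sub (integrable_bernsteinKernel hre) (integrable_bernsteinKernel hre'),
      ← integral_sub hsub ((hintc _).const_mul z),
      ← hm, ← hm, moment, moment, ← integral_sub (hint _) (hint _), ← integral_const_mul]
    exact norm_integral_le_of_norm_le (((hint _).sub (hint _)).const_mul _)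
      (Eventually.of_forall (norm_bernsteinKernel_sub_le hq hz))
  set l := lam (q + R + 2) with hldef
  have hl0 : 0 < l := lam_succ_pos _
  -- Increments of `lam` are at most 1, so stepping back R + 1 indices loses at most R + 1 ≤ l/2.
  have hq1 : l / 2 ≤ lam (q + 1) := by
    have h := lam_add_le (q + 1) (R + 1)
    rw [show q + 1 + (R + 1) = q + R + 2 by ring, ← hldef] at h
    push_cast at h
    linarith
  have h1 : 1 / lam (q + 1) - 1 / lam (q + 2) ≤ 8 / l ^ 3 :=
    calc _ ≤ 1 / lam (q + 1) ^ 3 := inv_lam_sub_inv_lam_le q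
      _ ≤ 1 / (l / 2) ^ 3 := by gcongr
      _ = 8 / l ^ 3 := by field_simp; norm_num
  have h2 : ‖z * (1 / lam (q + R + 2 + 1)) - z / l‖ ≤ R * (1 / l ^ 3) := by
    have e : z * (1 / lam (q + R + 2 + 1)) - z / l =
        -(z * ((1 / l - 1 / lam (q + R + 2 + 1) : ℝ) : ℂ)) := by
      push_cast
      ring
    have hnn : 0 ≤ 1 / l - 1 / lam (q + R + 2 + 1) := by
      have := (lam_lt_succ (q + R + 2)).le
      rw [sub_nonneg]
      gcongr
    rw [e, norm_neg, norm_mul, Complex.norm_real, Real.norm_of_nonneg hnn]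
    gcongr
    exact inv_lam_sub_inv_lam_le (q + R + 1)
  calc _ = ‖(bernstein μ (z + (q + R + 2 : ℕ)) - l - z * (1 / lam (q + R + 2 + 1))) +
        (z * (1 / lam (q + R + 2 + 1)) - z / l)‖ := by congr 1; ring
    _ ≤ (R ^ 2 + R) * (8 / l ^ 3) + R * (1 / l ^ 3) := by
      refine (norm_add_le _ _).trans (add_le_add (hmain.trans ?_) h2)
      gcongr
    _ = _ := by ring

/-- Both families have the form l·exp(δz), where δ is the logarithm of a ratio of consecutive λ's.
Only δ = l⁻² + O(l⁻⁴) matters. -/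
theorem norm_mul_exp_sub_le {l δ R : ℝ} (hl : 1 ≤ l) (hδ : |δ - 1 / l ^ 2| ≤ 4 / l ^ 4) {z : ℂ}
    (hz : ‖z‖ ≤ R) :
    ‖l * Complex.exp (δ * z) - l - z / l‖ ≤ (25 * R ^ 2 * Real.exp (5 * R) + 4 * R) / l ^ 3 := by
  have hl0 : 0 < l := by linarith
  have hR : 0 ≤ R := (norm_nonneg z).trans hz
  have hl4 : 4 / l ^ 4 ≤ 4 / l ^ 2 := by
    exact div_le_div_of_nonneg_left (by norm_num) (by positivity) (pow_le_pow_right₀ hl (by norm_num))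
  have hδ' : |δ| ≤ 5 / l ^ 2 := by
    have h := abs_sub_abs_le_abs_sub δ (1 / l ^ 2)
    rw [abs_of_pos (show 0 < 1 / l ^ 2 by positivity)] at h
    have e : 5 / l ^ 2 = 4 / l ^ 2 + 1 / l ^ 2 := by ring
    linarith
  have hx : ‖(δ : ℂ) * z‖ ≤ 5 / l ^ 2 * R := by
    rw [norm_mul, Complex.norm_real, Real.norm_eq_abs]
    gcongr
  have hx' : ‖(δ : ℂ) * z‖ ≤ 5 * R := by
    refine hx.trans ?_
    gcongr
    exact div_le_self (by norm_num) (one_le_pow₀ hl)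
  have e : l * Complex.exp (δ * z) - l - z / l =
      l * (Complex.exp (δ * z) - 1 - δ * z) + l * (z * ((δ - 1 / l ^ 2 : ℝ) : ℂ)) := by
    have : (l : ℂ) ≠ 0 := mod_cast hl0.ne'
    push_cast
    field_simp
    ring
  rw [e]
  calc _ ≤ l * ((5 / l ^ 2 * R) ^ 2 * Real.exp (5 * R)) + l * (R * (4 / l ^ 4)) := by
        refine (norm_add_le _ _).trans (add_le_add ?_ ?_)
        · rw [norm_mul, Complex.norm_real, Real.norm_of_nonneg hl0.le]
          gcongr
          exact (norm_exp_sub_one_sub_le _).trans (by gcongr)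
        · rw [norm_mul, norm_mul, Complex.norm_real, Complex.norm_real,
            Real.norm_of_nonneg hl0.le, Real.norm_eq_abs]
          gcongr
    _ = _ := by
      field_simp
      ring

/-- From 1 - 1/x ≤ log x ≤ x - 1 at x = λ_{k+1}/λ_k: the recursion makes the lower bound exactly
1/λ_{k+1}², and the upper bound exceeds it by 1/(λ_k λ_{k+1}³). -/
theorem abs_log_lam_div_sub_le {k : ℕ} (hk : 2 ≤ lam (k + 1)) (hk0 : 0 < lam k) :
    |Real.log (lam (k + 1) / lam k) - 1 / lam (k + 1) ^ 2| ≤ 2 / lam (k + 1) ^ 4 := by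
  have hl0 := lam_succ_pos k
  have h := lam_succ_mul_sub k
  set l := lam (k + 1)
  have hup := Real.log_le_sub_one_of_pos (div_pos hl0 hk0)
  have hlow := Real.log_le_sub_one_of_pos (div_pos hk0 hl0)
  rw [← inv_div l, Real.log_inv] at hlow
  have hx : lam k = l - 1 / l := by
    field_simp
    linarith
  have hx1 : 1 / l ≤ l / 2 := by
    rw [div_le_div_iff₀ hl0 two_pos]
    nlinarith
  have e1 : (l / lam k)⁻¹ - 1 = -(1 / l ^ 2) := by
    rw [inv_div]
    field_simp
    linarith
  have e2 : l / lam k - 1 - 1 / l ^ 2 = 1 / (lam k * l ^ 3) := by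
    field_simp
    linear_combination (l ^ 2 + 1) * h
  have e3 : 1 / (lam k * l ^ 3) ≤ 2 / l ^ 4 := by
    rw [div_le_div_iff₀ (by positivity) (by positivity)]
    have : l ≤ 2 * lam k := by linarith
    nlinarith [pow_pos hl0 3]
  rw [abs_le]
  constructor
  · have : 0 < 2 / l ^ 4 := by positivity
    linarith
  · linarith

theorem norm_a_sub_le {n : ℕ} (hn : 2 ≤ lam n) {R : ℝ} {z : ℂ} (hz : ‖z‖ ≤ R) :
    ‖a n z - lam n - z / lam n‖ ≤ (25 * R ^ 2 * Real.exp (5 * R) + 4 * R) / lam n ^ 3 := by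
  obtain ⟨k, rfl⟩ : ∃ k, n = k + 1 := Nat.exists_eq_succ_of_ne_zero (by rintro rfl; simp at hn; linarith)
  have hk0 : 0 < lam k := by have := lam_succ_le k; linarith
  have hpos := div_pos (lam_succ_pos k) hk0
  have h := norm_mul_exp_sub_le (z := z) (R := R) (show 1 ≤ lam (k + 1) by linarith)
    ((abs_log_lam_div_sub_le hn hk0).trans (by gcongr; norm_num)) hz
  rwa [Complex.ofReal_log hpos.le, ← Complex.cpow_def_of_ne_zero (mod_cast hpos.ne')] at h

theorem norm_b_sub_le {n : ℕ} (hn : 2 ≤ lam n) {R : ℝ} {z : ℂ} (hz : ‖z‖ ≤ R) :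
    ‖b n z - lam n - z / lam n‖ ≤ (25 * R ^ 2 * Real.exp (5 * R) + 4 * R) / lam n ^ 3 := by
  have hn0 : 0 < lam n := by linarith
  have hlt := lam_lt_succ n
  have hpos := div_pos (lam_succ_pos n) hn0
  have h1 := abs_log_lam_div_sub_le (hn.trans hlt.le) hn0
  have h2 : |1 / lam (n + 1) ^ 2 - 1 / lam n ^ 2| ≤ 2 / lam n ^ 4 := by
    have h3 := lam_succ_mul_sub n
    have h4 := lam_succ_pos n
    rw [abs_sub_comm, abs_of_nonneg (sub_nonneg.2 (by gcongr)), div_sub_div _ _ (by positivity)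
      (by positivity), div_le_div_iff₀ (by positivity) (by positivity)]
    -- The difference of squares is at most 2λ_{n+1}(λ_{n+1} - λ_n) = 2.
    have h5 : lam (n + 1) ^ 2 - lam n ^ 2 ≤ 2 := by nlinarith
    have h6 : lam n ^ 4 ≤ lam n ^ 2 * lam (n + 1) ^ 2 := by
      rw [show lam n ^ 4 = lam n ^ 2 * lam n ^ 2 by ring]
      gcongr
    have h7 : 0 ≤ lam (n + 1) ^ 2 - lam n ^ 2 := by nlinarith
    calc _ = (lam (n + 1) ^ 2 - lam n ^ 2) * lam n ^ 4 := by ring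
      _ ≤ 2 * (lam n ^ 2 * lam (n + 1) ^ 2) := by gcongr
  have h3 : |Real.log (lam (n + 1) / lam n) - 1 / lam n ^ 2| ≤ 4 / lam n ^ 4 := by
    refine (abs_sub_le _ (1 / lam (n + 1) ^ 2) _).trans ?_
    have : 2 / lam (n + 1) ^ 4 ≤ 2 / lam n ^ 4 := by gcongr
    have e : 4 / lam n ^ 4 = 2 / lam n ^ 4 + 2 / lam n ^ 4 := by ring
    linarith
  have h := norm_mul_exp_sub_le (z := z) (R := R) (show 1 ≤ lam n by linarith) h3 hz
  rwa [Complex.ofReal_log hpos.le, ← Complex.cpow_def_of_ne_zero (mod_cast hpos.ne')] at h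

end FixedPointMeasure

/-! ### Meromorphic extension through sphere-valued maps -/

namespace FixedPointMeasure

open MeasureTheory

/-- The inversion `w ↦ 1 / w` from the plane to the Riemann sphere. -/
noncomputable def sphereInv (w : ℂ) : OnePoint ℂ := open Classical in if w = 0 then ∞ else (w⁻¹ : ℂ)

theorem sphereInv_zero : sphereInv 0 = ∞ := if_pos rfl

theorem sphereInv_of_ne {w : ℂ} (hw : w ≠ 0) : sphereInv w = ((w⁻¹ : ℂ) : OnePoint ℂ) := if_neg hw

/-- A sphere-valued map that is holomorphic near a point and not constant there. -/
structure IsSphereHolomorphicAt (g : ℂ → OnePoint ℂ) (z : ℂ) : Prop where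
  eventually_ne : ∀ c, ∀ᶠ w in 𝓝[≠] z, g w ≠ c
  chart : (∃ h : ℂ → ℂ, AnalyticAt ℂ h z ∧ ∀ᶠ w in 𝓝 z, g w = h w) ∨
    ∃ h : ℂ → ℂ, AnalyticAt ℂ h z ∧ h z = 0 ∧ ∀ᶠ w in 𝓝 z, g w = sphereInv (h w)

theorem IsSphereHolomorphicAt.congr {g g' : ℂ → OnePoint ℂ} {z : ℂ}
    (hg : IsSphereHolomorphicAt g z) (h : g' =ᶠ[𝓝 z] g) : IsSphereHolomorphicAt g' z := by
  refine ⟨fun c => ?_, ?_⟩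
  · filter_upwards [hg.eventually_ne c, h.filter_mono nhdsWithin_le_nhds] with w h1 h2
    rwa [h2]
  · rcases hg.chart with ⟨k, hk, e⟩ | ⟨k, hk, h0, e⟩
    · exact Or.inl ⟨k, hk, by filter_upwards [h, e] with w h1 h2; rw [h1, h2]⟩
    · exact Or.inr ⟨k, hk, h0, by filter_upwards [h, e] with w h1 h2; rw [h1, h2]⟩

/-- The map has degree two: a nonempty fibre over a finite point is {w₀, -1/w₀}, and the fibre over
∞ is {0, ∞}. Finiteness lets local nonconstancy pass through `psi`. -/
theorem finite_psi_preimage (c : OnePoint ℂ) : {p | psi p = c}.Finite := by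
  induction c using OnePoint.rec with
  | infty =>
    refine (Set.toFinite {∞, ((0 : ℂ) : OnePoint ℂ)}).subset fun p hp => ?_
    induction p using OnePoint.rec with
    | infty => simp
    | coe w =>
      rcases eq_or_ne w 0 with rfl | hw
      · simp
      · rw [Set.mem_ofPred_eq, psi_coe hw] at hp
        exact absurd hp (OnePoint.coe_ne_infty _)
  | coe c =>
    have key : ∀ p, psi p = (c : OnePoint ℂ) → ∃ w : ℂ, p = w ∧ w ≠ 0 ∧ w - 1 / w = c := by
      intro p hp
      induction p using OnePoint.rec with
      | infty => exact absurd hp (OnePoint.infty_ne_coe _)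
      | coe w =>
        rcases eq_or_ne w 0 with rfl | hw
        · rw [psi_zero] at hp
          exact absurd hp (OnePoint.infty_ne_coe _)
        · rw [psi_coe hw] at hp
          exact ⟨w, rfl, hw, OnePoint.coe_injective hp⟩
    rcases Set.eq_empty_or_nonempty {p | psi p = (c : OnePoint ℂ)} with he | ⟨p₀, hp₀⟩
    · rw [he]
      exact Set.finite_empty
    obtain ⟨w₀, -, hw₀, e₀⟩ := key p₀ hp₀
    refine (Set.toFinite {(w₀ : OnePoint ℂ), ((-1 / w₀ : ℂ) : OnePoint ℂ)}).subset fun p hp => ?_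
    obtain ⟨w, rfl, hw, e⟩ := key p hp
    have h : (w - w₀) * (w * w₀ + 1) = 0 := by
      rw [← e₀] at e
      field_simp at e
      linear_combination e
    rcases mul_eq_zero.1 h with h | h
    · left
      rw [sub_eq_zero.1 h]
    · right
      rw [Set.mem_singleton_iff, eq_div_of_mul_eq hw₀ (eq_neg_of_add_eq_zero_left h)]

/-- In charts: near a zero of h, ψ(h) is the inverse of h/(h² - 1); if g = 1/h near a pole, ψ(g) is
the inverse of h/(1 - h²). -/
theorem IsSphereHolomorphicAt.psi {g : ℂ → OnePoint ℂ} {z : ℂ}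
    (hg : IsSphereHolomorphicAt g z) : IsSphereHolomorphicAt (fun w => psi (g w)) z := by
  refine ⟨fun c => ?_, ?_⟩
  · have h := (eventually_all_finite (finite_psi_preimage c)).2 fun p _ => hg.eventually_ne p
    filter_upwards [h] with w hw hc
    exact hw _ hc rfl
  · rcases hg.chart with ⟨h, hh, e⟩ | ⟨h, hh, h0, e⟩
    · rcases eq_or_ne (h z) 0 with h0 | h0
      · have hd : h z ^ 2 - 1 ≠ 0 := by simp [h0]
        have hda : AnalyticAt ℂ (fun w => h w ^ 2 - 1) z := (hh.pow 2).sub analyticAt_const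
        refine Or.inr ⟨fun w => h w / (h w ^ 2 - 1), hh.div hda hd, by simp [h0], ?_⟩
        filter_upwards [e, hda.continuousAt.eventually_ne hd] with w e1 e2
        rw [e1]
        rcases eq_or_ne (h w) 0 with h1 | h1
        · rw [h1, zero_div, sphereInv_zero, psi_zero]
        · rw [psi_coe h1, sphereInv_of_ne (div_ne_zero h1 e2)]
          congr 1
          field_simp
      · refine Or.inl ⟨fun w => h w - 1 / h w, hh.sub (analyticAt_const.div hh h0), ?_⟩
        filter_upwards [e, hh.continuousAt.eventually_ne h0] with w e1 e2
        rw [e1, psi_coe e2]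
    · have hd : 1 - h z ^ 2 ≠ 0 := by simp [h0]
      have hda : AnalyticAt ℂ (fun w => 1 - h w ^ 2) z := analyticAt_const.sub (hh.pow 2)
      refine Or.inr ⟨fun w => h w / (1 - h w ^ 2), hh.div hda hd, by simp [h0], ?_⟩
      filter_upwards [e, hda.continuousAt.eventually_ne hd] with w e1 e2
      rw [e1]
      rcases eq_or_ne (h w) 0 with h1 | h1
      · rw [h1, zero_div, sphereInv_zero, psi_infty]
      · rw [sphereInv_of_ne h1, psi_coe (inv_ne_zero h1), sphereInv_of_ne (div_ne_zero h1 e2)]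
        congr 1
        field_simp

theorem IsSphereHolomorphicAt.psi_iterate {g : ℂ → OnePoint ℂ} {z : ℂ}
    (hg : IsSphereHolomorphicAt g z) (m : ℕ) :
    IsSphereHolomorphicAt (fun w => FixedPointMeasure.psi^[m] (g w)) z := by
  induction m with
  | zero => exact hg
  | succ m ih => simpa only [Function.iterate_succ_apply'] using ih.psi

/-- The complex number underlying a point of the sphere, `0` at `∞`. -/
def finitePart (p : OnePoint ℂ) : ℂ := p.elim 0 id

theorem finitePart_infty : finitePart ∞ = 0 := rfl

theorem finitePart_coe (z : ℂ) : finitePart (z : OnePoint ℂ) = z := rfl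

/-- At a pole `finitePart` agrees with h⁻¹, including the value 0 at zeros of h, which is the
normal-form convention. Nonconstancy excludes h ≡ 0, so the order is really negative. -/
theorem IsSphereHolomorphicAt.meromorphicNFAt_and_sphereValue {g : ℂ → OnePoint ℂ} {z : ℂ}
    (hg : IsSphereHolomorphicAt g z) :
    MeromorphicNFAt (fun w => finitePart (g w)) z ∧
      sphereValue (fun w => finitePart (g w)) z = g z := by
  rcases hg.chart with ⟨h, hh, e⟩ | ⟨h, hh, h0, e⟩
  · have e' : (fun w => finitePart (g w)) =ᶠ[𝓝 z] h := by
      filter_upwards [e] with w hw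
      rw [hw, finitePart_coe]
    have ha : AnalyticAt ℂ (fun w => finitePart (g w)) z := hh.congr e'.symm
    refine ⟨ha.meromorphicNFAt, ?_⟩
    rw [sphereValue, if_neg (not_lt.2 ha.meromorphicOrderAt_nonneg), e.self_of_nhds, finitePart_coe]
  · have e' : (fun w => finitePart (g w)) =ᶠ[𝓝 z] h⁻¹ := by
      filter_upwards [e] with w hw
      rw [hw, Pi.inv_apply]
      rcases eq_or_ne (h w) 0 with h1 | h1
      · rw [h1, sphereInv_zero, finitePart_infty, inv_zero]
      · rw [sphereInv_of_ne h1, finitePart_coe]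
    have hnf : MeromorphicNFAt (fun w => finitePart (g w)) z :=
      (meromorphicNFAt_congr e').2 hh.meromorphicNFAt.inv
    refine ⟨hnf, ?_⟩
    have hne : ∀ᶠ w in 𝓝[≠] z, h w ≠ 0 := by
      filter_upwards [hg.eventually_ne ∞, e.filter_mono nhdsWithin_le_nhds] with w h1 h2 h3
      rw [h2, h3, sphereInv_zero] at h1
      exact h1 rfl
    have ht : Tendsto h (𝓝[≠] z) (𝓝[≠] 0) := by
      refine tendsto_nhdsWithin_iff.2 ⟨?_, hne⟩
      rw [← h0]
      exact hh.continuousAt.tendsto.mono_left nhdsWithin_le_nhds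
    have hord : meromorphicOrderAt (fun w => finitePart (g w)) z < 0 := by
      rw [← tendsto_cobounded_iff_meromorphicOrderAt_neg hnf.meromorphicAt]
      exact ((tendsto_inv₀_nhdsNE_zero (α := ℂ)).comp ht).congr'
        (e'.filter_mono nhdsWithin_le_nhds).symm
    rw [sphereValue, if_pos hord, e.self_of_nhds, h0, sphereInv_zero]

/-- Infinite order of the difference spreads over the connected plane, and normal forms that agree
on a punctured neighbourhood agree at its centre. -/
theorem MeromorphicNFOn.eq_of_eventuallyEq {f g : ℂ → ℂ} (hf : MeromorphicNFOn f Set.univ)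
    (hg : MeromorphicNFOn g Set.univ) {z₀ : ℂ} (h : f =ᶠ[𝓝 z₀] g) : f = g := by
  have hd : MeromorphicOn (f - g) Set.univ := hf.meromorphicOn.sub hg.meromorphicOn
  have h0 : meromorphicOrderAt (f - g) z₀ = ⊤ := by
    rw [meromorphicOrderAt_eq_top_iff]
    filter_upwards [h.filter_mono nhdsWithin_le_nhds] with w hw
    simp [hw]
  have hall : ∀ z : ℂ, meromorphicOrderAt (f - g) z = ⊤ := by
    by_contra! hne
    obtain ⟨z, hz⟩ := hne
    have := (hd.exists_meromorphicOrderAt_ne_top_iff_forall isConnected_univ).1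
      ⟨⟨z, trivial⟩, hz⟩ ⟨z₀, trivial⟩
    exact this h0
  funext z
  have h1 : f =ᶠ[𝓝[≠] z] g := by
    filter_upwards [meromorphicOrderAt_eq_top_iff.1 (hall z)] with w hw
    exact sub_eq_zero.1 hw
  exact (((hf trivial).eventuallyEq_nhdsNE_iff_eventuallyEq_nhds (hg trivial)).1 h1).self_of_nhds

theorem IsMeromorphicExtension.eq {μ : Measure unitInterval} {f g : ℂ → ℂ} (hf : IsMeromorphicExtension μ f)
    (hg : IsMeromorphicExtension μ g) : f = g := by
  refine MeromorphicNFOn.eq_of_eventuallyEq hf.meromorphic hg.meromorphic (z₀ := 1) ?_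
  filter_upwards [(isOpen_lt continuous_const Complex.continuous_re).mem_nhds
    (show (0 : ℝ) < (1 : ℂ).re by simp)] with w hw
  rw [hf.extends_bernstein w hw, hg.extends_bernstein w hw]

/-- The sphere-valued extension of the Bernstein transform by the functional equation. -/
noncomputable def sphereExt (μ : Measure unitInterval) (z : ℂ) : OnePoint ℂ :=
  psi^[⌈3 - z.re⌉₊] (bernstein μ (z + ⌈3 - z.re⌉₊) : OnePoint ℂ)

section

variable {μ : Measure unitInterval} [IsProbabilityMeasure μ]

theorem psi_iterate_bernstein (hm : ∀ n, moment μ n = 1 / lam (n + 1)) {z : ℂ} {m : ℕ}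
    (hz : 0 < (z + m).re) (k : ℕ) :
    psi^[m + k] (bernstein μ (z + (m + k : ℕ)) : OnePoint ℂ) =
      psi^[m] (bernstein μ (z + m) : OnePoint ℂ) := by
  induction k with
  | zero => rfl
  | succ k ih =>
    have hz' : 0 < (z + (m + k : ℕ)).re := by
      rw [Complex.add_re, Complex.natCast_re] at hz ⊢
      push_cast
      linarith [Nat.cast_nonneg (α := ℝ) k]
    have e : z + (m + (k + 1) : ℕ) = z + (m + k : ℕ) + 1 := by push_cast; ring
    rw [← ih, e, ← add_assoc, Function.iterate_succ_apply,
      psi_coe (bernstein_add_one_ne_zero hm hz'), ← bernstein_eq_sub_inv hm hz']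

theorem sphereExt_eq (hm : ∀ n, moment μ n = 1 / lam (n + 1)) {z : ℂ} {m : ℕ}
    (hz : 0 < (z + m).re) : sphereExt μ z = psi^[m] (bernstein μ (z + m) : OnePoint ℂ) := by
  have h0 : 0 < (z + (⌈3 - z.re⌉₊ : ℕ)).re := by
    have := Nat.le_ceil (3 - z.re)
    rw [Complex.add_re, Complex.natCast_re]
    linarith
  rw [sphereExt, ← psi_iterate_bernstein hm h0 m, ← psi_iterate_bernstein hm hz ⌈3 - z.re⌉₊,
    add_comm m]

theorem sphereExt_of_re_pos (hm : ∀ n, moment μ n = 1 / lam (n + 1)) {z : ℂ} (hz : 0 < z.re) :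
    sphereExt μ z = (bernstein μ z : OnePoint ℂ) := by
  have h := sphereExt_eq hm (z := z) (m := 0) (by simpa using hz)
  simpa using h

/-- By the identity theorem, accumulation of a value would make the transform constant on a
half-plane, contradicting the distinct values `lam` at integers. -/
theorem isSphereHolomorphicAt_bernstein (hm : ∀ n, moment μ n = 1 / lam (n + 1)) {z : ℂ} {m : ℕ}
    (hz : 2 < (z + m).re) :
    IsSphereHolomorphicAt (fun w => (bernstein μ (w + m) : OnePoint ℂ)) z := by
  have hset : {w : ℂ | 2 < (w + m).re} = {w : ℂ | 2 - (m : ℝ) < w.re} := by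
    ext w
    simp [sub_lt_iff_lt_add]
  have hopen : IsOpen {w : ℂ | 2 < (w + m).re} := by
    rw [hset]
    exact isOpen_lt continuous_const Complex.continuous_re
  have hana : AnalyticOnNhd ℂ (fun w => bernstein μ (w + m)) {w : ℂ | 2 < (w + m).re} := by
    refine DifferentiableOn.analyticOnNhd (fun w hw => ?_) hopen
    exact (DifferentiableAt.comp (g := bernstein μ) (f := fun w => w + (m : ℂ)) w
      (differentiableAt_bernstein hw)
      (differentiableAt_id.add_const _)).differentiableWithinAt
  refine ⟨fun c => ?_, Or.inl ⟨_, hana z hz, Eventually.of_forall fun _ => rfl⟩⟩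
  induction c using OnePoint.rec with
  | infty => exact Eventually.of_forall fun _ => OnePoint.coe_ne_infty _
  | coe c =>
    by_contra hcon
    have hfreq : ∃ᶠ w in 𝓝[≠] z, bernstein μ (w + m) = c := fun h =>
      hcon (h.mono fun w hw hc => hw (OnePoint.coe_injective hc))
    have hpre : IsPreconnected {w : ℂ | 2 < (w + m).re} := by
      rw [hset]
      exact (convex_halfSpace_re_gt _).isPreconnected
    have heq := hana.eqOn_of_preconnected_of_frequently_eq analyticOnNhd_const hpre hz hfreq
    have hval : ∀ k : ℕ, 2 < k → (lam (k + m) : ℂ) = c := by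
      intro k hk
      have hk' : (2 : ℝ) < ((k : ℂ) + m).re := by
        rw [Complex.add_re, Complex.natCast_re, Complex.natCast_re]
        have : (2 : ℝ) < k := by exact_mod_cast hk
        linarith [Nat.cast_nonneg (α := ℝ) m]
      have h1 : bernstein μ ((k : ℂ) + m) = c := heq hk'
      obtain ⟨j, hj⟩ : ∃ j, k + m = j + 1 := ⟨k + m - 1, by omega⟩
      rw [hj, ← bernstein_natCast hm j, ← hj, ← h1]
      push_cast
      rfl
    have h34 := (hval 3 (by norm_num)).trans (hval 4 (by norm_num)).symm
    have := lam_strictMono.injective (Complex.ofReal_injective h34)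
    omega

theorem isSphereHolomorphicAt_sphereExt (hm : ∀ n, moment μ n = 1 / lam (n + 1)) (z : ℂ) :
    IsSphereHolomorphicAt (sphereExt μ) z := by
  set m := ⌈3 - z.re⌉₊ with hmdef
  -- The 3 in `sphereExt` puts the shifted point inside Re > 2, where holomorphy was proved.
  have hre : 3 ≤ (z + m).re := by
    have := Nat.le_ceil (3 - z.re)
    rw [Complex.add_re, Complex.natCast_re]
    linarith
  refine ((isSphereHolomorphicAt_bernstein hm (z := z) (m := m) (by linarith)).psi_iterate
    m).congr ?_
  have hcont : ContinuousAt (fun w : ℂ => (w + m).re) z := by fun_prop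
  filter_upwards [hcont.eventually_const_lt (show 0 < (z + m).re by linarith)] with w hw
  exact sphereExt_eq hm hw

theorem isMeromorphicExtension_finitePart (hm : ∀ n, moment μ n = 1 / lam (n + 1)) :
    IsMeromorphicExtension μ (fun z => finitePart (sphereExt μ z)) := by
  refine ⟨fun z _ => (isSphereHolomorphicAt_sphereExt hm z).meromorphicNFAt_and_sphereValue.1,
    fun z hz => ?_⟩
  rw [sphereExt_of_re_pos hm hz, finitePart_coe]

/-! ### Convergence of the iterates -/

/-- Families asymptotic to `lam n + z / lam n` track the Bernstein transform backwards. -/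
theorem exists_psi_iterate_error (hm : ∀ n, moment μ n = 1 / lam (n + 1)) (R : ℕ)
    {c : ℕ → ℂ → ℂ} {C : ℝ} (hC : 0 ≤ C)
    (hc : ∀ n, 2 ≤ lam n → ∀ z : ℂ, ‖z‖ ≤ R → ‖c n z - lam n - z / lam n‖ ≤ C / lam n ^ 3) :
    ∃ m N : ℕ, ∃ D : ℝ, R < m ∧ 0 ≤ D ∧ ∀ n, N ≤ n → ∀ z : ℂ, ‖z‖ ≤ R →
      ∃ v : ℂ, psi^[n] (c n z : OnePoint ℂ) = psi^[m] (v : OnePoint ℂ) ∧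
        ‖v - bernstein μ (z + m)‖ ≤ D / lam n := by
  set B : ℝ := 8 * (R ^ 2 + R) + R with hB
  have hB0 : 0 ≤ B := by positivity
  -- The threshold collects 2(R + 1) for the asymptotics, 8 for the error recursion, and R + B to
  -- keep f(z+k) within 1 of `lam k`.
  obtain ⟨m, hmR, hml⟩ : ∃ m, R + 3 ≤ m ∧ 2 * (R + 1) + 8 + R + B ≤ lam m :=
    ((eventually_ge_atTop (R + 3)).and (tendsto_lam.eventually_ge_atTop _)).exists
  -- The condition B + C ≤ `lam N` makes the initial weighted error (B + C)/λ_n at most 1, as the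
  -- recursion requires.
  obtain ⟨N, hNm, hNl⟩ : ∃ N, m ≤ N ∧ B + C ≤ lam N :=
    ((eventually_ge_atTop m).and (tendsto_lam.eventually_ge_atTop _)).exists
  refine ⟨m, N, B + C, by omega, by positivity, fun n hn z hz => ?_⟩
  have hR0 : (0 : ℝ) ≤ R := Nat.cast_nonneg R
  have hlam : ∀ k, m ≤ k → 2 * (R + 1) + 8 + R + B ≤ lam k := fun k hk =>
    hml.trans (lam_strictMono.monotone hk)
  have hb : ∀ k, m ≤ k → ‖bernstein μ (z + k) - lam k - z / lam k‖ ≤ B / lam k ^ 3 := fun k hk =>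
    norm_bernstein_add_natCast_sub_le hm (by omega) (by linarith [hlam k hk]) hz
  have hw : ∀ k, m ≤ k → ‖bernstein μ (z + k) - lam k‖ ≤ 1 := by
    intro k hk
    have hl := hlam k hk
    have hl0 : 0 < lam k := by linarith
    have h1 : ‖z / (lam k : ℂ)‖ ≤ R / lam k := by
      rw [norm_div, Complex.norm_real, Real.norm_of_nonneg hl0.le]
      gcongr
    have h2 : B / lam k ^ 3 ≤ B / lam k := by
      exact div_le_div_of_nonneg_left hB0 hl0 (le_self_pow₀ (by linarith) (by norm_num))
    calc _ = ‖(bernstein μ (z + k) - lam k - z / lam k) + z / lam k‖ := by congr 1; ring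
      _ ≤ B / lam k + R / lam k := (norm_add_le _ _).trans (add_le_add ((hb k hk).trans h2) h1)
      _ = (B + R) / lam k := by ring
      _ ≤ 1 := div_le_one_of_le₀ (by linarith) hl0.le
  have hψ : ∀ k : ℕ, m ≤ k → bernstein μ (z + k) =
      bernstein μ (z + (k + 1 : ℕ)) - 1 / bernstein μ (z + (k + 1 : ℕ)) := by
    intro k hk
    have hre : 0 < (z + k).re := by
      have h1 := (abs_le.1 (Complex.abs_re_le_norm z)).1
      have h2 : ((R + 3 : ℕ) : ℝ) ≤ k := by exact_mod_cast hmR.trans hk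
      push_cast at h2
      rw [Complex.add_re, Complex.natCast_re]
      linarith
    rw [Nat.cast_succ, ← add_assoc]
    exact bernstein_eq_sub_inv hm hre
  have hln : B + C ≤ lam n := hNl.trans (lam_strictMono.monotone hn)
  have hl := hlam n (by omega)
  have hl0 : 0 < lam n := by linarith
  obtain ⟨j, rfl⟩ : ∃ j, n = m + j := ⟨n - m, by omega⟩
  have hv : ‖c (m + j) z - bernstein μ (z + (m + j : ℕ))‖ * lam (m + j) ^ 2 ≤
      (B + C) / lam (m + j) := by
    have h1 := hc (m + j) (by linarith) z hz
    have h2 := hb (m + j) (by omega)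
    have h3 : ‖c (m + j) z - bernstein μ (z + (m + j : ℕ))‖ ≤ (B + C) / lam (m + j) ^ 3 := by
      calc _ = ‖(c (m + j) z - lam (m + j) - z / lam (m + j)) -
            (bernstein μ (z + (m + j : ℕ)) - lam (m + j) - z / lam (m + j))‖ := by
            congr 1; ring
        _ ≤ C / lam (m + j) ^ 3 + B / lam (m + j) ^ 3 :=
          (norm_sub_le _ _).trans (add_le_add h1 h2)
        _ = _ := by ring
    calc _ ≤ (B + C) / lam (m + j) ^ 3 * lam (m + j) ^ 2 := by gcongr
      _ = _ := by field_simp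
  obtain ⟨v, h1, h2⟩ := psi_iterate_error (w := fun k => bernstein μ (z + k))
    (by linarith) hw hψ (div_le_one_of_le₀ hln hl0.le) j le_rfl hv
  refine ⟨v, by rw [Function.iterate_add_apply, h1], le_trans ?_ h2⟩
  exact le_mul_of_one_le_right (norm_nonneg _) (one_le_pow₀ (by linarith))

theorem sphereExt_eq_of_norm_le (hm : ∀ n, moment μ n = 1 / lam (n + 1)) {R m : ℕ} (hR : R < m)
    {z : ℂ} (hz : ‖z‖ ≤ R) :
    sphereExt μ z = psi^[m] (bernstein μ (z + m) : OnePoint ℂ) := by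
  refine sphereExt_eq hm ?_
  have h1 := (abs_le.1 (Complex.abs_re_le_norm z)).1
  have h2 : (R : ℝ) < m := by exact_mod_cast hR
  rw [Complex.add_re, Complex.natCast_re]
  linarith

theorem tendsto_div_lam (D : ℝ) : Tendsto (fun n => D / lam n) atTop (𝓝 0) :=
  tendsto_lam.const_div_atTop D

theorem tendsto_psi_iterate (hm : ∀ n, moment μ n = 1 / lam (n + 1)) {c : ℕ → ℂ → ℂ}
    (hc : ∀ R : ℕ, ∃ C : ℝ, 0 ≤ C ∧ ∀ n, 2 ≤ lam n → ∀ z : ℂ, ‖z‖ ≤ R →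
      ‖c n z - lam n - z / lam n‖ ≤ C / lam n ^ 3) (z : ℂ) :
    Tendsto (fun n => psi^[n] (c n z : OnePoint ℂ)) atTop (𝓝 (sphereExt μ z)) := by
  obtain ⟨R, hR⟩ := exists_nat_ge ‖z‖
  obtain ⟨C, hC, hc⟩ := hc R
  obtain ⟨m, N, D, hRm, -, h⟩ := exists_psi_iterate_error hm R hC hc
  choose! v hv using fun n hn => h n hn z hR
  have hlim : Tendsto v atTop (𝓝 (bernstein μ (z + m))) := by
    rw [tendsto_iff_norm_sub_tendsto_zero]
    refine squeeze_zero' (Eventually.of_forall fun _ => norm_nonneg _) ?_ (tendsto_div_lam D)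
    filter_upwards [eventually_ge_atTop N] with n hn
    exact (hv n hn).2
  have hcont := (continuous_psi.iterate m).comp OnePoint.continuous_coe
  rw [sphereExt_eq_of_norm_le hm hRm hR]
  refine ((hcont.tendsto _).comp hlim).congr' ?_
  filter_upwards [eventually_ge_atTop N] with n hn
  exact (hv n hn).1.symm

theorem chordalTendstoUniformlyOn_psi_iterate (hm : ∀ n, moment μ n = 1 / lam (n + 1))
    {c : ℕ → ℂ → ℂ}
    (hc : ∀ R : ℕ, ∃ C : ℝ, 0 ≤ C ∧ ∀ n, 2 ≤ lam n → ∀ z : ℂ, ‖z‖ ≤ R →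
      ‖c n z - lam n - z / lam n‖ ≤ C / lam n ^ 3) {K : Set ℂ} (hK : IsCompact K) :
    ChordalTendstoUniformlyOn (fun n z => psi^[n] (c n z : OnePoint ℂ)) (sphereExt μ) K := by
  intro ε hε
  obtain ⟨r, hr⟩ := hK.isBounded.exists_norm_le
  obtain ⟨R, hR⟩ := exists_nat_ge r
  obtain ⟨C, hC, hc⟩ := hc R
  obtain ⟨m, N, D, hRm, -, h⟩ := exists_psi_iterate_error hm R hC hc
  -- The exponent `m` depends on `R` only, so the Lipschitz factor is constant while the error tends
  -- to 0.
  have hlim : Tendsto (fun n => 4 ^ m * (2 * (D / lam n))) atTop (𝓝 (4 ^ m * (2 * 0))) :=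
    ((tendsto_div_lam D).const_mul 2).const_mul _
  rw [mul_zero, mul_zero] at hlim
  obtain ⟨N', hN'⟩ := eventually_atTop.1 (hlim.eventually_lt_const hε)
  refine ⟨max N N', fun n hn z hz => ?_⟩
  have hzR := (hr z hz).trans hR
  obtain ⟨v, h1, h2⟩ := h n ((le_max_left _ _).trans hn) z hzR
  refine lt_of_le_of_lt ?_ (hN' n ((le_max_right _ _).trans hn))
  beta_reduce
  rw [h1, sphereExt_eq_of_norm_le hm hRm hzR]
  refine (chordalDist_psi_iterate_le m _ _).trans ?_
  gcongr
  exact (chordalDist_coe_le _ _).trans (by gcongr)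

end

end FixedPointMeasure

theorem theorem1p3 :
    (∃! μ : MeasureTheory.Measure unitInterval, FixedPointMeasure.IsFixedPointMeasure μ) ∧
    ∀ μ : MeasureTheory.Measure unitInterval, FixedPointMeasure.IsFixedPointMeasure μ →
      (∃! f : ℂ → ℂ, FixedPointMeasure.IsMeromorphicExtension μ f) ∧
      ∀ f : ℂ → ℂ, FixedPointMeasure.IsMeromorphicExtension μ f →
        (∀ z : ℂ,
          Tendsto (fun n : ℕ => FixedPointMeasure.psi^[n] (FixedPointMeasure.a n z : OnePoint ℂ))
            atTop (𝓝 (FixedPointMeasure.sphereValue f z)) ∧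
          Tendsto (fun n : ℕ => FixedPointMeasure.psi^[n] (FixedPointMeasure.b n z : OnePoint ℂ))
            atTop (𝓝 (FixedPointMeasure.sphereValue f z))) ∧
        (∀ K : Set ℂ, IsCompact K →
          FixedPointMeasure.ChordalTendstoUniformlyOn
            (fun n z => FixedPointMeasure.psi^[n] (FixedPointMeasure.a n z : OnePoint ℂ))
            (FixedPointMeasure.sphereValue f) K ∧
          FixedPointMeasure.ChordalTendstoUniformlyOn
            (fun n z => FixedPointMeasure.psi^[n] (FixedPointMeasure.b n z : OnePoint ℂ))
            (FixedPointMeasure.sphereValue f) K) := by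
  refine ⟨FixedPointMeasure.existsUnique_isFixedPointMeasure, fun μ hμ => ?_⟩
  have := hμ.isProbabilityMeasure
  have hm := FixedPointMeasure.isFixedPointMeasure_iff_moment.1 hμ
  have hext := FixedPointMeasure.isMeromorphicExtension_finitePart hm
  refine ⟨⟨_, hext, fun g hg => hg.eq hext⟩, fun f hf => ?_⟩
  -- By uniqueness every extension is the one built from `sphereExt`, whose sphere value is
  -- `sphereExt` itself.
  obtain rfl := hf.eq hext
  have hval : FixedPointMeasure.sphereValue
      (fun z => FixedPointMeasure.finitePart (FixedPointMeasure.sphereExt μ z)) =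
      FixedPointMeasure.sphereExt μ := funext fun z =>
    (FixedPointMeasure.isSphereHolomorphicAt_sphereExt hm z).meromorphicNFAt_and_sphereValue.2
  rw [hval]
  have ha : ∀ R : ℕ, ∃ C : ℝ, 0 ≤ C ∧ ∀ n, 2 ≤ FixedPointMeasure.lam n → ∀ z : ℂ, ‖z‖ ≤ R →
      ‖FixedPointMeasure.a n z - FixedPointMeasure.lam n - z / FixedPointMeasure.lam n‖ ≤
        C / FixedPointMeasure.lam n ^ 3 := fun R =>
    ⟨_, by positivity, fun _ hn _ hz => FixedPointMeasure.norm_a_sub_le hn hz⟩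
  have hb : ∀ R : ℕ, ∃ C : ℝ, 0 ≤ C ∧ ∀ n, 2 ≤ FixedPointMeasure.lam n → ∀ z : ℂ, ‖z‖ ≤ R →
      ‖FixedPointMeasure.b n z - FixedPointMeasure.lam n - z / FixedPointMeasure.lam n‖ ≤
        C / FixedPointMeasure.lam n ^ 3 := fun R =>
    ⟨_, by positivity, fun _ hn _ hz => FixedPointMeasure.norm_b_sub_le hn hz⟩
  exact ⟨fun z => ⟨FixedPointMeasure.tendsto_psi_iterate hm ha z,
      FixedPointMeasure.tendsto_psi_iterate hm hb z⟩,
    fun K hK => ⟨FixedPointMeasure.chordalTendstoUniformlyOn_psi_iterate hm ha hK,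
      FixedPointMeasure.chordalTendstoUniformlyOn_psi_iterate hm hb hK⟩⟩
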